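/- Let $\mathcal X$ be a finite alphabet with at least two letters, $\mathcal P(\mathcal X)$ the set of probability distributions on it, and let $M,T$ be integers with $0<T\le\lceil M/2-1\rceil$ (that is, $0<2T<M$). Let $\mathcal S(T)$ be the set of subsets of $[M]=\{1,\dots,M\}$ of size $T$. For $P_{\rm N},P_{\rm A}\in\mathcal P(\mathcal X)$ and $\mathcal B\in\mathcal S(T)$, let $\mathbb P_{\mathcal B}$ be the law of $M$ independent infinite sequences $X_1,\dots,X_M$, where $X_j$ is i.i.d. with law $P_{\rm A}$ if $j\in\mathcal B$ and with law $P_{\rm N}$ if $j\notin\mathcal B$, and let $\mathbb E_{\mathcal B}$ be the expectation under it. A sequential test $\Phi=(\tau,\phi)$ consists of a stopping time $\tau\in\{0,1,\dots,\infty\}$ of the filtration $(\mathcal F_k)_k$, where $\mathcal F_k$ is generated by the first $k$ symbols of all $M$ sequences, and of a decision rule $\phi$ that maps the symbols observed up to time $\tau$ to an element of $\mathcal S(T)$. Its misclassification probability is $\psi_{\mathcal B}(\Phi|P_{\rm N},P_{\rm A})=1-\mathbb P_{\mathcal B}\{\tau<\infty,\ \phi=\mathcal B\}$. The test satisfies the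 expected stopping time universality constraint with $n\in\mathbb N$ if $\max_{\mathcal B\in\mathcal S(T)}\mathbb E_{\mathcal B}[\tau]\le n$ for all $(P_{\rm N},P_{\rm A})\in\mathcal P(\mathcal X)^2$. For a family $\Phi=(\Phi_n)_n$ of sequential tests put $$E_{\mathcal B}(\Phi|P_{\rm N},P_{\rm A})=\liminf_{n\to\infty}\frac{-\log\psi_{\mathcal B}(\Phi_n|P_{\rm N},P_{\rm A})}{n}\in[0,\infty],\qquad -\log 0=\infty .$$ Let $D(P\|Q)=\sum_x P(x)\log\frac{P(x)}{Q(x)}$. For $\mathbf Q=(Q_1,\dots,Q_M)\in\mathcal P(\mathcal X)^M$ and $\mathcal B\in\mathcal S(T)$ let $$\mathrm G_{\mathcal B}(\mathbf Q)=\sum_{j\notin\mathcal B}D\Big(Q_j\Big\|\tfrac{1}{M-T}\sum_{l\notin\mathcal B}Q_l\Big)+\sum_{i\in\mathcal B}D\Big(Q_i\Big\|\tfrac1T\sum_{t\in\mathcal B}Q_t\Big),$$ let $\mathrm S_{\mathcal B}(\mathbf x^k)$ be $\mathrm G_{\mathcal B}$ evaluated at the empirical distributions of the first $k$ symbols of the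 $M$ sequences, and let $f(k)=(M+1)|\mathcal X|\log(k+1)/k$. For each $n$, the test $\Phi_{{\rm seq},n}$ stops at $\tau=\inf\{k\ge n-1:\exists\,\mathcal C\in\mathcal S(T),\ \mathrm S_{\mathcal C}(\mathbf x^k)\le f(k)\}$ and decides for a minimizer of $\mathcal C\mapsto\mathrm S_{\mathcal C}(\mathbf x^\tau)$ over $\mathcal S(T)$, ties being broken arbitrarily; $\Phi_{\rm seq}=(\Phi_{{\rm seq},n})_n$. For $\alpha\in[0,1)$ let $D_\alpha(P\|Q)=\frac1{\alpha-1}\log\sum_xP(x)^\alpha Q(x)^{1-\alpha}\in[0,\infty]$, with $0^0=1$ and value $\infty$ if the sum is $0$, and $$\mathrm{LD}(P_{\rm N},P_{\rm A},M,T)=\min_{0\le t\le T-1}(T-t)\Big(D_{\frac tT}(P_{\rm A}\|P_{\rm N})+D_{\frac{M-2T+t}{M-T}}(P_{\rm N}\|P_{\rm A})\Big).$$ **Theorem.** (Achievability.) For every $n\ge2$, the test $\Phi_{{\rm seq},n}$ satisfies the expected stopping time universality constraint with $n$. For every pair $(P_{\rm N},P_{\rm A})$ of fully supported distributions and every $\mathcal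 B\in\mathcal S(T)$, $$E_{\mathcal B}(\Phi_{\rm seq}|P_{\rm N},P_{\rm A})\ge\mathrm{LD}(P_{\rm N},P_{\rm A},M,T).$$ (Converse.) Let $\Phi=(\Phi_n)_n$ be any family of sequential tests such that, for all sufficiently large $n$, $\Phi_n$ satisfies the expected stopping time universality constraint with $n$. (a) If $\psi_{\mathcal B}(\Phi_n|P_{\rm N},P_{\rm A})\to0$ as $n\to\infty$ for every $\mathcal B\in\mathcal S(T)$ and all fully supported $P_{\rm N}\ne P_{\rm A}$, then $E_{\mathcal B}(\Phi|P_{\rm N},P_{\rm A})\le\mathrm{LD}(P_{\rm N},P_{\rm A},M,T)$ for every $\mathcal B\in\mathcal S(T)$ and all fully supported $P_{\rm N},P_{\rm A}$ (equal or not). (b) If $\psi_{\mathcal B}(\Phi_n|P_{\rm N},P_{\rm A})\to0$ as $n\to\infty$ for every $\mathcal B\in\mathcal S(T)$ and all $P_{\rm N}\ne P_{\rm A}$ in $\mathcal P(\mathcal X)$, then $E_{\mathcal B}(\Phi|P_{\rm N},P_{\rm A})\le\mathrm{LD}(P_{\rm N},P_{\rm A},M,T)$ for every $\mathcal B\in\mathcal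 S(T)$ and all $P_{\rm N},P_{\rm A}\in\mathcal P(\mathcal X)$ such that $P_{\rm N}$ is not a point mass. -/

import Mathlib

open MeasureTheory Filter Topology
open scoped ENNReal

namespace OutlierTest

/-- The family `𝒮(T)` of candidate outlier sets: the subsets of `{1, …, M}` of size `T`. -/
abbrev OutlierSet (M T : ℕ) : Type := {B : Finset (Fin M) // B.card = T}

/-- Sample paths: `ω k j` is the `(k + 1)`-st symbol of the `j`-th observed sequence. -/
abbrev Path (X : Type*) (M : ℕ) : Type _ := ℕ → Fin M → X

/-- The first `k` symbols of all `M` sequences. -/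
def pathPrefix {X : Type*} {M : ℕ} (k : ℕ) (ω : Path X M) : Fin k → Fin M → X :=
  fun i => ω i

/-- The observation filtration: `ℱ k` is generated by the first `k` symbols of all `M` sequences
(so `ℱ 0` is trivial). -/
def obsFiltration (X : Type*) [mX : MeasurableSpace X] (M : ℕ) :
    Filtration ℕ (inferInstance : MeasurableSpace (Path X M)) where
  seq k := MeasurableSpace.comap (pathPrefix k) inferInstance
  mono' := by
    intro k l hkl
    have h : (pathPrefix k : Path X M → _) =
        (fun (y : Fin l → Fin M → X) (i : Fin k) => y (Fin.castLE hkl i)) ∘ pathPrefix l := rfl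
    change MeasurableSpace.comap _ _ ≤ MeasurableSpace.comap _ _
    rw [h, ← MeasurableSpace.comap_comp]
    refine MeasurableSpace.comap_mono ?_
    refine Measurable.comap_le ?_
    exact measurable_pi_lambda _ fun i => measurable_pi_apply _
  le' := by
    intro k
    refine Measurable.comap_le ?_
    exact measurable_pi_lambda _ fun i => measurable_pi_apply _

/-- A sequential test for exactly `T` outliers among `M` sequences: a stopping time of the
observation filtration (the value `⊤` means that the test never stops) and a decision rule that
maps the symbols observed up to the stopping time to an outlier set. -/
structure SeqTest (X : Type*) [MeasurableSpace X] (M T : ℕ) where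
  /-- The stopping time. -/
  τ : Path X M → ℕ∞
  isStoppingTime : IsStoppingTime (obsFiltration X M) τ
  /-- The decision taken from the first `k` symbols of every sequence when the test stops at
  time `k`. -/
  φ : (k : ℕ) → (Fin k → Fin M → X) → OutlierSet M T

/-- The law of the observations under the hypothesis that `B` is the set of outliers: all symbols
are independent, those of the sequences in `B` have law `PA`, those of the others law `PN`. -/
noncomputable def hypLaw {X : Type*} [MeasurableSpace X] {M T : ℕ} (PN PA : PMF X)
    (B : OutlierSet M T) : Measure (Path X M) :=
  Measure.infinitePi fun _ : ℕ =>
    Measure.pi fun j : Fin M => (if j ∈ B.1 then PA else PN).toMeasure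

/-- The misclassification probability: the probability, when `B` is the set of outliers, that the
test does not stop with the decision `B`. -/
noncomputable def misclassProb {X : Type*} [MeasurableSpace X] {M T : ℕ} (Φ : SeqTest X M T)
    (PN PA : PMF X) (B : OutlierSet M T) : ℝ≥0∞ :=
  hypLaw PN PA B {ω | ¬ ∃ k : ℕ, Φ.τ ω = k ∧ Φ.φ k (pathPrefix k ω) = B}

/-- The expected stopping time when `B` is the set of outliers. -/
noncomputable def expStopTime {X : Type*} [MeasurableSpace X] {M T : ℕ} (Φ : SeqTest X M T)
    (PN PA : PMF X) (B : OutlierSet M T) : ℝ≥0∞ :=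
  ∫⁻ ω, (Φ.τ ω : ℝ≥0∞) ∂(hypLaw PN PA B)

/-- The expected stopping time universality constraint with the integer `n`: for *all* pairs of
distributions and all outlier sets the expected stopping time is at most `n`. -/
def SatisfiesEST {X : Type*} [MeasurableSpace X] {M T : ℕ} (Φ : SeqTest X M T) (n : ℕ) : Prop :=
  ∀ (PN PA : PMF X) (B : OutlierSet M T), expStopTime Φ PN PA B ≤ n

/-- The error exponent of a family of tests indexed by the bound `n` on the expected stopping
time: `liminf_n (- log ψ_B(Φ n)) / n`, with `- log 0 = ⊤`. -/
noncomputable def errorExponent {X : Type*} [MeasurableSpace X] {M T : ℕ}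
    (Φ : ℕ → SeqTest X M T) (PN PA : PMF X) (B : OutlierSet M T) : EReal :=
  liminf (fun n : ℕ => (- ENNReal.log (misclassProb (Φ n) PN PA B)) / (n : EReal)) atTop

/-- The error probabilities of the family `Φ` vanish under the pair `(PN, PA)`, whatever the
outlier set is. -/
def VanishingError {X : Type*} [MeasurableSpace X] {M T : ℕ}
    (Φ : ℕ → SeqTest X M T) (PN PA : PMF X) : Prop :=
  ∀ B : OutlierSet M T, Tendsto (fun n : ℕ => misclassProb (Φ n) PN PA B) atTop (𝓝 0)

/-- Kullback–Leibler divergence of two mass functions on a finite alphabet, as a finite sum of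
reals. It is used below only when `Q x = 0` implies `P x = 0`; then the conventions of the real
logarithm and division give `0 log (0 / q) = 0` for all `q`. -/
noncomputable def relEntropy {X : Type*} [Fintype X] (P Q : X → ℝ) : ℝ :=
  ∑ x, P x * Real.log (P x / Q x)

/-- The arithmetic mean of the mass functions `Q l`, `l ∈ B`. -/
noncomputable def groupMean {X : Type*} {M : ℕ} (B : Finset (Fin M)) (Q : Fin M → X → ℝ) :
    X → ℝ :=
  fun x => (∑ l ∈ B, Q l x) / (B.card : ℝ)

/-- The two-group score `G_B(Q)`: the divergences of the members of each of the two groups `Bᶜ`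
and `B` from the mean of their group, summed. -/
noncomputable def twoGroupG {X : Type*} [Fintype X] {M : ℕ} (B : Finset (Fin M))
    (Q : Fin M → X → ℝ) : ℝ :=
  ∑ j ∈ Bᶜ, relEntropy (Q j) (groupMean Bᶜ Q) + ∑ i ∈ B, relEntropy (Q i) (groupMean B Q)

/-- The type (empirical distribution) of a string of length `k`. -/
noncomputable def empirical {X : Type*} [DecidableEq X] {k : ℕ} (x : Fin k → X) : X → ℝ :=
  fun a => (∑ i, if x i = a then (1 : ℝ) else 0) / (k : ℝ)

/-- The score `S_C(x^k)`: the two-group score of the types of the `M` observed strings. -/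
noncomputable def score {X : Type*} [Fintype X] [DecidableEq X] {M T : ℕ} (C : OutlierSet M T)
    {k : ℕ} (x : Fin k → Fin M → X) : ℝ :=
  twoGroupG C.1 fun j => empirical fun i => x i j

/-- The threshold `f(k) = (M + 1) |X| log (k + 1) / k`. -/
noncomputable def threshold (X : Type*) [Fintype X] (M k : ℕ) : ℝ :=
  ((M : ℝ) + 1) * (Fintype.card X : ℝ) * Real.log ((k : ℝ) + 1) / (k : ℝ)

/-- The times `k ≥ n - 1` at which some outlier set has a score not exceeding the threshold. -/
def stopTimes {X : Type*} [Fintype X] [DecidableEq X] (M T n : ℕ) (ω : Path X M) : Set ℕ :=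
  {k | n - 1 ≤ k ∧ ∃ C : OutlierSet M T, score C (pathPrefix k ω) ≤ threshold X M k}

/-- The infimum of the above times, `⊤` if there are none. -/
noncomputable def seqStopTime {X : Type*} [Fintype X] [DecidableEq X] (M T n : ℕ)
    (ω : Path X M) : ℕ∞ :=
  ⨅ k ∈ stopTimes M T n ω, (k : ℕ∞)

theorem isStoppingTime_seqStopTime {X : Type*} [Fintype X] [DecidableEq X] [MeasurableSpace X]
    [MeasurableSingletonClass X] (M T n : ℕ) :
    IsStoppingTime (obsFiltration X M) (seqStopTime (X := X) M T n) := by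
  intro i
  have h : {ω : Path X M | seqStopTime M T n ω ≤ (i : ℕ∞)} =
      ⋃ k ∈ Finset.range (i + 1), {ω : Path X M | k ∈ stopTimes M T n ω} := by
    ext ω
    simp only [Set.mem_ofPred_eq, Set.mem_iUnion, Finset.mem_range, exists_prop]
    constructor
    · intro hω
      by_contra hcon
      have : ((i + 1 : ℕ) : ℕ∞) ≤ seqStopTime M T n ω := by
        refine le_iInf₂ fun k hk => ?_
        by_contra hlt
        have hlt' : k < i + 1 := by exact_mod_cast not_le.mp hlt
        exact hcon ⟨k, hlt', hk⟩
      have h2 : ((i + 1 : ℕ) : ℕ∞) ≤ (i : ℕ∞) := this.trans hω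
      have h3 : i + 1 ≤ i := by exact_mod_cast h2
      omega
    · rintro ⟨k, hki, hk⟩
      refine (iInf₂_le k hk).trans ?_
      exact_mod_cast Nat.lt_succ_iff.mp hki
  change MeasurableSet[obsFiltration X M i] {ω : Path X M | seqStopTime M T n ω ≤ (i : ℕ∞)}
  rw [h]
  refine Finset.measurableSet_biUnion _ fun k hk => ?_
  have hki : k ≤ i := Nat.lt_succ_iff.mp (Finset.mem_range.mp hk)
  refine (obsFiltration X M).mono hki _ ?_
  exact ⟨{y | n - 1 ≤ k ∧ ∃ C : OutlierSet M T, score C y ≤ threshold X M k},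
    (Set.toFinite _).measurableSet, rfl⟩

/-- The rule `φ` decides for a minimizer of the score (ties are broken arbitrarily). -/
def IsMinScoreRule {X : Type*} [Fintype X] [DecidableEq X] {M T : ℕ}
    (φ : (k : ℕ) → (Fin k → Fin M → X) → OutlierSet M T) : Prop :=
  ∀ (k : ℕ) (x : Fin k → Fin M → X) (C : OutlierSet M T), score (φ k x) x ≤ score C x

/-- The sequential test with parameter `n`: it stops at the first time `k ≥ n - 1` at which some
score is at most `f(k)`, and then applies the decision rule `φ`, which is to be a minimal score
rule. -/
noncomputable def seqTest {X : Type*} [Fintype X] [DecidableEq X] [MeasurableSpace X]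
    [MeasurableSingletonClass X] {M T : ℕ} (n : ℕ)
    (φ : (k : ℕ) → (Fin k → Fin M → X) → OutlierSet M T) : SeqTest X M T where
  τ := seqStopTime M T n
  isStoppingTime := isStoppingTime_seqStopTime M T n
  φ := φ

/-- The Rényi divergence `D_α(P‖Q) = (α - 1)⁻¹ log ∑ x, P(x)^α Q(x)^(1-α)`, with values in the
extended reals: it is `⊤` if `α < 1` and the sum vanishes. -/
noncomputable def renyiDiv {X : Type*} [Fintype X] (α : ℝ) (P Q : PMF X) : EReal :=
  ((1 / (α - 1) : ℝ) : EReal) * ENNReal.log (∑ x, P x ^ α * Q x ^ (1 - α))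

/-- The exponent `LD`: the minimum over `t = 0, …, T - 1` of
`(T - t) (D_{t/T}(PA‖PN) + D_{(M-2T+t)/(M-T)}(PN‖PA))`. -/
noncomputable def LD {X : Type*} [Fintype X] (PN PA : PMF X) (M T : ℕ) : EReal :=
  ⨅ t : Fin T, (((T : ℝ) - (t : ℝ) : ℝ) : EReal) *
    (renyiDiv ((t : ℝ) / (T : ℝ)) PA PN +
      renyiDiv (((M : ℝ) - 2 * (T : ℝ) + (t : ℝ)) / ((M : ℝ) - (T : ℝ))) PN PA)

end OutlierTest

/-! Achievability is the method of types. If `B` is the truth, the probability that the `M` types at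
time `k` lie in a set on which their total divergence from the true laws is at least `d` is at most
`(k+1)^(M|X|) e^(-kd)` (`measureReal_pathPrefix_le_exp_mul`). The score of `B` is at most that total
divergence, because group means minimise sums of divergences. With `d = f(k)`, the score of `B`
therefore exceeds the threshold with probability at most `(k+1)^(-|X|) ≤ (k+1)^(-2)`, and the sum of
these over `k ≥ n - 1` costs at most one expected step beyond `n - 1`.

An error requires some `C ≠ B` whose score falls below the threshold at some `k ≥ n - 1`. Then all
types inside `C`, and all inside its complement, are nearly equal to their means `V` and `W`. If `C`
and `B` share `t` elements, the total divergence is, up to `O(√f(k))`, at least `t D(V‖PA) + (T-t)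
D(V‖PN) + (M-2T+t) D(W‖PN) + (T-t) D(W‖PA)`. By Gibbs' inequality, the minimum over `V` and `W` is
attained at normalised geometric means of `PA` and `PN`, and it equals the term of `LD` with index
`t` (`overlapExponent_sub_le`). A geometric series over `k` finishes the argument.

The converse is a change of measure. Under a competing hypothesis `C` with nominal law `W` and
outlier law `V`, the test must decide for `C` with probability tending to one. Wald's identity
bounds the divergence of the stopped observations by `n` times the divergence per time step, since
the expected stopping time is at most `n` under every pair of laws. Data processing
(`mul_measureReal_stop_sub_le`) then forces the exponent under `B` to be at most the divergence per
step (`errorExponent_le_sum_relEntropy`). The geometric means as `V` and `W` give the terms of `LD`.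
Errors need not vanish when `V = W`; that case is circumvented in `errorExponent_le_overlapTerm`. -/

namespace OutlierTest

/-! ### Inequalities for divergences on a finite alphabet. -/

section Information

variable {X : Type*} [Fintype X]

/-- Gibbs' inequality, for a reference function that need not be normalised. -/
theorem neg_log_sum_le_relEntropy {V G : X → ℝ} (hV : V ∈ stdSimplex ℝ X) (hG : ∀ a, 0 ≤ G a)
    (hVG : ∀ a, V a ≠ 0 → G a ≠ 0) : -Real.log (∑ a, G a) ≤ relEntropy V G := by
  have hZ : 0 < ∑ a, G a := by
    obtain ⟨a, ha⟩ : ∃ a, V a ≠ 0 := by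
      by_contra! h
      have := hV.2
      simp [h] at this
    exact Finset.sum_pos' (fun a _ => hG a)
      ⟨a, Finset.mem_univ a, lt_of_le_of_ne (hG a) (hVG a ha).symm⟩
  set Z := ∑ a, G a with hZdef
  -- This is `log x ≥ 1 - 1/x` at `x = V a * Z / G a`; the left sides sum to zero.
  have key : ∀ a, V a - G a / Z ≤ V a * Real.log (V a / G a) + V a * Real.log Z := by
    intro a
    rcases eq_or_ne (V a) 0 with h | h
    · simp only [h, zero_mul, zero_sub, add_zero]
      have := div_nonneg (hG a) hZ.le
      linarith
    · have hv : 0 < V a := lt_of_le_of_ne (hV.1 a) h.symm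
      have hg : 0 < G a := lt_of_le_of_ne (hG a) (hVG a h).symm
      have h1 := Real.one_sub_inv_le_log_of_pos (x := V a / G a * Z) (by positivity)
      rw [Real.log_mul (by positivity) hZ.ne'] at h1
      have h2 : V a * (1 - (V a / G a * Z)⁻¹) = V a - G a / Z := by
        field_simp
      rw [← mul_add, ← h2]
      exact mul_le_mul_of_nonneg_left h1 hv.le
  have hsum := Finset.sum_le_sum fun a (_ : a ∈ Finset.univ) => key a
  rw [Finset.sum_sub_distrib, Finset.sum_add_distrib, ← Finset.sum_div, ← Finset.sum_mul, hV.2,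
    ← hZdef, div_self hZ.ne'] at hsum
  unfold relEntropy
  linarith

theorem relEntropy_nonneg {P Q : X → ℝ} (hP : P ∈ stdSimplex ℝ X) (hQ : Q ∈ stdSimplex ℝ X)
    (hPQ : ∀ a, P a ≠ 0 → Q a ≠ 0) : 0 ≤ relEntropy P Q := by
  have := neg_log_sum_le_relEntropy hP hQ.1 hPQ
  rwa [hQ.2, Real.log_one, neg_zero] at this

/-- The squared Hellinger distance is bounded by the divergence. -/
theorem sum_sq_sqrt_sub_sqrt_le_relEntropy {P Q : X → ℝ} (hP : P ∈ stdSimplex ℝ X)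
    (hQ : Q ∈ stdSimplex ℝ X) (hPQ : ∀ a, P a ≠ 0 → Q a ≠ 0) :
    ∑ a, (√(P a) - √(Q a)) ^ 2 ≤ relEntropy P Q := by
  -- The same bound `log x ≥ 1 - 1/x`, now at `x = √(P a / Q a)`. The linear term `P a - Q a`
  -- completes the square and sums to zero.
  have key : ∀ a, (√(P a) - √(Q a)) ^ 2 + (P a - Q a) ≤ P a * Real.log (P a / Q a) := by
    intro a
    rcases eq_or_ne (P a) 0 with h | h
    · simp [h, Real.sq_sqrt (hQ.1 a)]
    · have hp : 0 < P a := lt_of_le_of_ne (hP.1 a) h.symm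
      have hq : 0 < Q a := lt_of_le_of_ne (hQ.1 a) (hPQ a h).symm
      have hsp := Real.sqrt_pos.2 hp
      have hsq := Real.sqrt_pos.2 hq
      have h1 := Real.one_sub_inv_le_log_of_pos (x := √(P a) / √(Q a)) (by positivity)
      have h2 : Real.log (P a / Q a) = 2 * Real.log (√(P a) / √(Q a)) := by
        rw [← Real.sqrt_div hp.le, Real.log_sqrt (by positivity)]
        ring
      have h3 := Real.sq_sqrt hp.le
      have h4 := Real.sq_sqrt hq.le
      have h5 : √(P a) ^ 2 * (1 - (√(P a) / √(Q a))⁻¹) = √(P a) ^ 2 - √(P a) * √(Q a) := by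
        field_simp
      have h6 := mul_le_mul_of_nonneg_left h1 (sq_nonneg √(P a))
      rw [h5, h3] at h6
      rw [h2]
      nlinarith
  have hsum := Finset.sum_le_sum fun a (_ : a ∈ Finset.univ) => key a
  rw [Finset.sum_add_distrib, Finset.sum_sub_distrib, hP.2, hQ.2, sub_self, add_zero] at hsum
  exact hsum

/-- A substitute for Pinsker's inequality: in `p - q = (√p - √q)(√p + √q)` the second factor is at
most `2` and the first is controlled by the Hellinger distance. -/
theorem abs_sub_le_two_mul_sqrt_relEntropy {P Q : X → ℝ} (hP : P ∈ stdSimplex ℝ X)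
    (hQ : Q ∈ stdSimplex ℝ X) (hPQ : ∀ a, P a ≠ 0 → Q a ≠ 0) (a : X) :
    |P a - Q a| ≤ 2 * √(relEntropy P Q) := by
  have hle_one : ∀ {R : X → ℝ}, R ∈ stdSimplex ℝ X → R a ≤ 1 := fun {R} hR => by
    rw [← hR.2]
    exact Finset.single_le_sum (fun b _ => hR.1 b) (Finset.mem_univ a)
  have h1 : |√(P a) - √(Q a)| ≤ √(relEntropy P Q) := by
    refine Real.abs_le_sqrt (le_trans ?_ (sum_sq_sqrt_sub_sqrt_le_relEntropy hP hQ hPQ))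
    exact Finset.single_le_sum (f := fun a => (√(P a) - √(Q a)) ^ 2)
      (fun b _ => sq_nonneg _) (Finset.mem_univ a)
  have h2 : P a - Q a = (√(P a) - √(Q a)) * (√(P a) + √(Q a)) := by
    have h3 := Real.sq_sqrt (hP.1 a)
    have h4 := Real.sq_sqrt (hQ.1 a)
    linear_combination -h3 + h4
  have h5 : √(P a) ≤ 1 := Real.sqrt_le_one.2 (hle_one hP)
  have h6 : √(Q a) ≤ 1 := Real.sqrt_le_one.2 (hle_one hQ)
  rw [h2, abs_mul, abs_of_nonneg (a := √(P a) + √(Q a)) (by positivity), mul_comm]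
  exact mul_le_mul (by linarith) h1 (abs_nonneg _) (by norm_num)

/-! ### Groups of laws and their means. -/

section Group

variable {M : ℕ} {B : Finset (Fin M)} {Q : Fin M → X → ℝ}

theorem groupMean_mem_stdSimplex (hB : B.Nonempty) (hQ : ∀ j, Q j ∈ stdSimplex ℝ X) :
    groupMean B Q ∈ stdSimplex ℝ X := by
  refine ⟨fun a => div_nonneg (Finset.sum_nonneg fun j _ => (hQ j).1 a) (Nat.cast_nonneg _), ?_⟩
  unfold groupMean
  rw [← Finset.sum_div, Finset.sum_comm, Finset.sum_congr rfl fun j _ => (hQ j).2]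
  have : (B.card : ℝ) ≠ 0 := by exact_mod_cast hB.card_pos.ne'
  simp [this]

theorem groupMean_ne_zero (hQ : ∀ j, Q j ∈ stdSimplex ℝ X) {j : Fin M} (hj : j ∈ B) {a : X}
    (ha : Q j a ≠ 0) : groupMean B Q a ≠ 0 := by
  have h1 : 0 < ∑ l ∈ B, Q l a := Finset.sum_pos' (fun l _ => (hQ l).1 a)
    ⟨j, hj, lt_of_le_of_ne ((hQ j).1 a) ha.symm⟩
  have h2 : 0 < B.card := Finset.card_pos.2 ⟨j, hj⟩
  unfold groupMean
  positivity

/-- The sum over a group of a linear functional depends only on the mean of the group. The right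
side keeps the form of a sum over the group so that it matches the sums of divergences. -/
theorem sum_mul_eq_sum_groupMean_mul (hB : B.Nonempty) (g : X → ℝ) :
    ∑ j ∈ B, ∑ a, Q j a * g a = ∑ _j ∈ B, ∑ a, groupMean B Q a * g a := by
  rw [Finset.sum_comm, Finset.sum_const, nsmul_eq_mul, Finset.mul_sum]
  refine Finset.sum_congr rfl fun a _ => ?_
  have : (B.card : ℝ) ≠ 0 := by exact_mod_cast hB.card_pos.ne'
  rw [← Finset.sum_mul]
  unfold groupMean
  field_simp

/-- Splitting the divergences of the members of a group from given laws at the mean. -/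
theorem sum_relEntropy_eq_add (hQ : ∀ j, Q j ∈ stdSimplex ℝ X)
    {P : Fin M → X → ℝ} (hQP : ∀ j ∈ B, ∀ a, Q j a ≠ 0 → P j a ≠ 0) :
    ∑ j ∈ B, relEntropy (Q j) (P j) = ∑ j ∈ B, relEntropy (Q j) (groupMean B Q) +
      ∑ j ∈ B, ∑ a, Q j a * (Real.log (groupMean B Q a) - Real.log (P j a)) := by
  rw [← Finset.sum_add_distrib]
  refine Finset.sum_congr rfl fun j hj => ?_
  unfold relEntropy
  rw [← Finset.sum_add_distrib]
  refine Finset.sum_congr rfl fun a _ => ?_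
  rcases eq_or_ne (Q j a) 0 with h | h
  · simp [h]
  · rw [Real.log_div h (hQP j hj a h), Real.log_div h (groupMean_ne_zero hQ hj h)]
    ring

theorem relEntropy_eq_sum_mul_log_sub {V P : X → ℝ} (hVP : ∀ a, V a ≠ 0 → P a ≠ 0) :
    relEntropy V P = ∑ a, V a * (Real.log (V a) - Real.log (P a)) := by
  refine Finset.sum_congr rfl fun a _ => ?_
  rcases eq_or_ne (V a) 0 with h | h
  · simp [h]
  · rw [Real.log_div h (hVP a h)]

/-- Compensation identity: the two sides differ by `B.card` times the divergence of the mean from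
`P`, which is nonnegative. -/
theorem sum_relEntropy_groupMean_le (hB : B.Nonempty) (hQ : ∀ j, Q j ∈ stdSimplex ℝ X)
    {P : X → ℝ} (hP : P ∈ stdSimplex ℝ X) (hQP : ∀ j ∈ B, ∀ a, Q j a ≠ 0 → P a ≠ 0) :
    ∑ j ∈ B, relEntropy (Q j) (groupMean B Q) ≤ ∑ j ∈ B, relEntropy (Q j) P := by
  have habs : ∀ a, groupMean B Q a ≠ 0 → P a ≠ 0 := by
    intro a ha
    obtain ⟨j, hj, hja⟩ : ∃ j ∈ B, Q j a ≠ 0 := by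
      by_contra! h
      exact ha (by simp [groupMean, Finset.sum_eq_zero h])
    exact hQP j hj a hja
  rw [sum_relEntropy_eq_add hQ (P := fun _ => P) hQP,
    sum_mul_eq_sum_groupMean_mul hB fun a => Real.log (groupMean B Q a) - Real.log (P a),
    ← relEntropy_eq_sum_mul_log_sub habs]
  have := relEntropy_nonneg (groupMean_mem_stdSimplex hB hQ) hP habs
  have h2 : 0 ≤ ∑ _j ∈ B, relEntropy (groupMean B Q) P := Finset.sum_nonneg fun _ _ => this
  linarith

/-- The divergences of the members of a homogeneous group from fully supported laws are almost
those of the mean. -/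
theorem sum_relEntropy_groupMean_sub_le (hB : B.Nonempty) (hQ : ∀ j, Q j ∈ stdSimplex ℝ X)
    {P : Fin M → X → ℝ} (hP : ∀ j a, P j a ≠ 0) {f L : ℝ}
    (hf : ∀ j ∈ B, relEntropy (Q j) (groupMean B Q) ≤ f)
    (hL : ∀ j a, |Real.log (P j a)| ≤ L) :
    ∑ j ∈ B, relEntropy (groupMean B Q) (P j) - B.card * Fintype.card X * (2 * √f * L) ≤
      ∑ j ∈ B, relEntropy (Q j) (P j) := by
  have hmean := groupMean_mem_stdSimplex hB hQ
  rw [sum_relEntropy_eq_add hQ (P := P) fun j _ a _ => hP j a]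
  have h0 : 0 ≤ ∑ j ∈ B, relEntropy (Q j) (groupMean B Q) := Finset.sum_nonneg fun j hj =>
    relEntropy_nonneg (hQ j) hmean fun a ha => groupMean_ne_zero hQ hj ha
  -- The factor `log (groupMean B Q a)` is unbounded, but it does not depend on `j`, so there `Q j`
  -- may be replaced by the mean exactly. Only the bounded factor `log (P j a)` produces an error.
  have h1 : ∑ j ∈ B, ∑ a, Q j a * (Real.log (groupMean B Q a) - Real.log (P j a)) =
      ∑ j ∈ B, ∑ a, groupMean B Q a * (Real.log (groupMean B Q a) - Real.log (P j a)) -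
      ∑ j ∈ B, ∑ a, (Q j a - groupMean B Q a) * Real.log (P j a) := by
    have := sum_mul_eq_sum_groupMean_mul (Q := Q) hB fun a => Real.log (groupMean B Q a)
    simp only [mul_sub, sub_mul, Finset.sum_sub_distrib, this]
    ring
  have h2 : ∑ j ∈ B, ∑ a, (Q j a - groupMean B Q a) * Real.log (P j a) ≤
      ∑ _j ∈ B, ∑ _a : X, 2 * √f * L := by
    refine Finset.sum_le_sum fun j hj => Finset.sum_le_sum fun a _ => ?_
    have h3 := abs_sub_le_two_mul_sqrt_relEntropy (hQ j) hmean
      (fun a ha => groupMean_ne_zero hQ hj ha) a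
    have h4 := Real.sqrt_le_sqrt (hf j hj)
    refine (le_abs_self _).trans ?_
    rw [abs_mul]
    exact mul_le_mul (h3.trans (by linarith)) (hL j a) (abs_nonneg _) (by positivity)
  have h5 : ∑ _j ∈ B, ∑ _a : X, 2 * √f * L = B.card * Fintype.card X * (2 * √f * L) := by
    simp [mul_assoc]
  rw [Finset.sum_congr rfl fun j _ => relEntropy_eq_sum_mul_log_sub fun a _ => hP j a]
  linarith

end Group

/-- The weighted sum of divergences from two laws is at least the exponent of their geometric
mean. -/
theorem neg_mul_log_sum_rpow_le {V P Q : X → ℝ} (hV : V ∈ stdSimplex ℝ X) (hP : ∀ a, 0 < P a)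
    (hQ : ∀ a, 0 < Q a) {u v N : ℝ} (hN : 0 < N) (huv : u + v = N) :
    -N * Real.log (∑ a, P a ^ (u / N) * Q a ^ (v / N)) ≤
      u * relEntropy V P + v * relEntropy V Q := by
  have hpos : ∀ a, 0 < P a ^ (u / N) * Q a ^ (v / N) := fun a =>
    mul_pos (Real.rpow_pos_of_pos (hP a) _) (Real.rpow_pos_of_pos (hQ a) _)
  have h := neg_log_sum_le_relEntropy (G := fun a => P a ^ (u / N) * Q a ^ (v / N)) hV
    (fun a => (hpos a).le) fun a _ => (hpos a).ne'
  -- Since `u + v = N`, the logarithm of the geometric mean is the weighted average of the two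
  -- logarithms.
  have h2 : N * relEntropy V (fun a => P a ^ (u / N) * Q a ^ (v / N)) =
      u * relEntropy V P + v * relEntropy V Q := by
    rw [relEntropy_eq_sum_mul_log_sub fun a _ => (hpos a).ne',
      relEntropy_eq_sum_mul_log_sub fun a _ => (hP a).ne',
      relEntropy_eq_sum_mul_log_sub fun a _ => (hQ a).ne', Finset.mul_sum, Finset.mul_sum,
      Finset.mul_sum, ← Finset.sum_add_distrib]
    refine Finset.sum_congr rfl fun a _ => ?_
    rw [Real.log_mul (Real.rpow_pos_of_pos (hP a) _).ne' (Real.rpow_pos_of_pos (hQ a) _).ne',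
      Real.log_rpow (hP a), Real.log_rpow (hQ a)]
    field_simp
    rw [← huv]
    ring
  rw [← h2]
  nlinarith

end Information

/-! ### The law of the first `k` symbols. -/

section PrefixLaw

variable {X : Type*} [MeasurableSpace X] {M : ℕ}

theorem measurable_pathPrefix (k : ℕ) : Measurable (pathPrefix k : Path X M → _) :=
  measurable_pi_lambda _ fun _ => measurable_pi_apply _

theorem map_pathPrefix_infinitePi (ρ : Measure (Fin M → X)) [IsProbabilityMeasure ρ] (k : ℕ) :
    (Measure.infinitePi fun _ : ℕ => ρ).map (pathPrefix k) = Measure.pi fun _ : Fin k => ρ := by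
  refine (Measure.pi_eq fun s hs => ?_).symm
  rw [Measure.map_apply (measurable_pathPrefix k) (MeasurableSet.univ_pi hs)]
  have h : (pathPrefix k : Path X M → _) ⁻¹' (Set.univ.pi s) =
      Set.pi (Finset.range k : Finset ℕ) fun i => if h : i < k then s ⟨i, h⟩ else Set.univ := by
    ext ω
    simp only [Set.mem_preimage, Set.mem_pi, Set.mem_univ, true_implies, pathPrefix,
      Finset.coe_range, Set.mem_Iio]
    constructor
    · intro H i hi
      simpa [hi] using H ⟨i, hi⟩
    · intro H i
      simpa using H i i.2
  rw [h, Measure.infinitePi_pi]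
  · rw [← Fin.prod_univ_eq_prod_range
      (fun i => ρ (if h : i < k then s ⟨i, h⟩ else Set.univ)) k]
    simp
  · intro i _
    split_ifs
    · exact hs _
    · exact MeasurableSet.univ

variable [Fintype X] [MeasurableSingletonClass X]

/-- Expectations of functions of the first `k` symbols are finite sums. -/
theorem integral_pathPrefix (ρ : Measure (Fin M → X)) [IsProbabilityMeasure ρ] (k : ℕ)
    (h : (Fin k → Fin M → X) → ℝ) :
    ∫ ω, h (pathPrefix k ω) ∂(Measure.infinitePi fun _ : ℕ => ρ) =
      ∑ y, (∏ i, ρ.real {y i}) * h y := by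
  classical
  rw [← integral_map (f := h) (measurable_pathPrefix k).aemeasurable
    (measurable_of_finite h).aestronglyMeasurable, map_pathPrefix_infinitePi,
    integral_fintype .of_finite]
  refine Finset.sum_congr rfl fun y _ => ?_
  rw [smul_eq_mul, measureReal_def, Measure.pi_singleton, ENNReal.toReal_prod]
  rfl

theorem integrable_pathPrefix (μ : Measure (Path X M)) [IsFiniteMeasure μ] (k : ℕ)
    (h : (Fin k → Fin M → X) → ℝ) : Integrable (fun ω => h (pathPrefix k ω)) μ :=
  (Integrable.of_finite (f := h)).comp_measurable (measurable_pathPrefix k)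

theorem measureReal_pathPrefix (ρ : Measure (Fin M → X)) [IsProbabilityMeasure ρ] (k : ℕ)
    (S : Set (Fin k → Fin M → X)) :
    (Measure.infinitePi fun _ : ℕ => ρ).real (pathPrefix k ⁻¹' S) =
      ∑ y, (∏ i, ρ.real {y i}) * S.indicator 1 y := by
  classical
  rw [← integral_pathPrefix, ← integral_indicator_one
    (measurable_pathPrefix k S.toFinite.measurableSet)]
  rfl

/-- Independence of the next symbols from the past; this is what Wald's identity needs. -/
theorem integral_pathPrefix_mul_apply (ρ : Measure (Fin M → X)) [IsProbabilityMeasure ρ] (k : ℕ)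
    (h : (Fin k → Fin M → X) → ℝ) (g : (Fin M → X) → ℝ) :
    ∫ ω, h (pathPrefix k ω) * g (ω k) ∂(Measure.infinitePi fun _ : ℕ => ρ) =
      (∫ ω, h (pathPrefix k ω) ∂(Measure.infinitePi fun _ : ℕ => ρ)) *
        ∑ z, ρ.real {z} * g z := by
  classical
  have h1 := integral_pathPrefix ρ (k + 1) fun y => h (fun i => y i.castSucc) * g (y (Fin.last k))
  rw [integral_pathPrefix ρ k h, Finset.sum_mul_sum]
  refine h1.trans ?_
  rw [← (Fin.snocEquiv fun _ => Fin M → X).sum_comp, Fintype.sum_prod_type, Finset.sum_comm]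
  refine Finset.sum_congr rfl fun y _ => Finset.sum_congr rfl fun z _ => ?_
  simp only [Fin.snocEquiv_apply, Fin.prod_univ_castSucc, Fin.snoc_castSucc, Fin.snoc_last]
  ring

end PrefixLaw

/-! ### The law of one time step. -/

section SymbolLaw

variable {X : Type*} [MeasurableSpace X] {M : ℕ}

/-- The law of the symbols that are observed at one time. -/
noncomputable def symbolLaw (P : Fin M → PMF X) : Measure (Fin M → X) :=
  Measure.pi fun j => (P j).toMeasure

instance (P : Fin M → PMF X) : IsProbabilityMeasure (symbolLaw P) := by
  unfold symbolLaw
  infer_instance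

theorem symbolLaw_real_singleton [MeasurableSingletonClass X] (P : Fin M → PMF X)
    (z : Fin M → X) : (symbolLaw P).real {z} = ∏ j, (P j (z j)).toReal := by
  rw [measureReal_def, symbolLaw, Measure.pi_singleton, ENNReal.toReal_prod]
  refine Finset.prod_congr rfl fun j _ => ?_
  rw [PMF.toMeasure_apply_singleton _ _ (measurableSet_singleton _)]

/-- The law of each of the sequences when `B` is the set of outliers. -/
noncomputable def hypPMF {T : ℕ} (PN PA : PMF X) (B : OutlierSet M T) (j : Fin M) : PMF X :=
  if j ∈ B.1 then PA else PN

theorem hypLaw_eq {T : ℕ} (PN PA : PMF X) (B : OutlierSet M T) :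
    hypLaw PN PA B = Measure.infinitePi fun _ : ℕ => symbolLaw (hypPMF PN PA B) := rfl

instance {T : ℕ} (PN PA : PMF X) (B : OutlierSet M T) :
    IsProbabilityMeasure (hypLaw PN PA B) := by
  rw [hypLaw_eq]
  infer_instance

end SymbolLaw

theorem toReal_mem_stdSimplex {X : Type*} [Fintype X] (P : PMF X) :
    (fun a => (P a).toReal) ∈ stdSimplex ℝ X := by
  refine ⟨fun a => ENNReal.toReal_nonneg, ?_⟩
  have h := P.tsum_coe
  rw [tsum_fintype] at h
  rw [← ENNReal.toReal_sum fun a _ => P.apply_ne_top a, h, ENNReal.toReal_one]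

/-! ### The method of types. -/

section Types

variable {X : Type*} [DecidableEq X]

theorem empirical_nonneg {k : ℕ} (x : Fin k → X) (a : X) : 0 ≤ empirical x a := by
  unfold empirical
  positivity

theorem empirical_apply_pos {k : ℕ} (x : Fin k → X) (i : Fin k) : 0 < empirical x (x i) := by
  have hk : 0 < k := i.pos
  unfold empirical
  refine div_pos (Finset.sum_pos' (fun _ _ => by positivity) ⟨i, Finset.mem_univ _, by simp⟩) ?_
  exact_mod_cast hk

theorem exists_of_empirical_ne_zero {k : ℕ} {x : Fin k → X} {a : X} (h : empirical x a ≠ 0) :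
    ∃ i, x i = a := by
  by_contra! hne
  exact h (by simp [empirical, hne])

variable [Fintype X]

theorem sum_empirical_mul {k : ℕ} (hk : 0 < k) (x : Fin k → X) (h : X → ℝ) :
    (k : ℝ) * ∑ a, empirical x a * h a = ∑ i, h (x i) := by
  have hk' : (k : ℝ) ≠ 0 := by exact_mod_cast hk.ne'
  unfold empirical
  rw [Finset.mul_sum]
  have h1 : ∀ a, (k : ℝ) * ((∑ i, if x i = a then (1 : ℝ) else 0) / k * h a) =
      ∑ i, if x i = a then h a else 0 := by
    intro a
    rw [← mul_assoc, mul_div_cancel₀ _ hk', Finset.sum_mul]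
    simp
  rw [Finset.sum_congr rfl fun a _ => h1 a, Finset.sum_comm]
  simp

theorem empirical_mem_stdSimplex {k : ℕ} (hk : 0 < k) (x : Fin k → X) :
    empirical x ∈ stdSimplex ℝ X := by
  refine ⟨empirical_nonneg x, ?_⟩
  have h := sum_empirical_mul hk x fun _ => 1
  have hk' : (k : ℝ) ≠ 0 := by exact_mod_cast hk.ne'
  simp only [mul_one, Finset.sum_const, Finset.card_univ, Fintype.card_fin, nsmul_eq_mul] at h
  exact mul_left_cancel₀ hk' (by rw [h, mul_one])

/-- The probability of a string through its type. -/
theorem prod_apply_eq_exp_mul {k : ℕ} (x : Fin k → X) {P : X → ℝ} (hP : ∀ i, 0 < P (x i)) :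
    ∏ i, P (x i) = Real.exp (-k * relEntropy (empirical x) P) * ∏ i, empirical x (x i) := by
  rcases Nat.eq_zero_or_pos k with rfl | hk
  · simp
  have h1 : (k : ℝ) * relEntropy (empirical x) P =
      ∑ i, Real.log (empirical x (x i) / P (x i)) :=
    sum_empirical_mul hk x fun a => Real.log (empirical x a / P a)
  rw [neg_mul, h1, ← Finset.sum_neg_distrib, Real.exp_sum, ← Finset.prod_mul_distrib]
  refine Finset.prod_congr rfl fun i _ => ?_
  have h2 := empirical_apply_pos x i
  rw [Real.exp_neg, Real.exp_log (div_pos h2 (hP i)), inv_div, div_mul_cancel₀ _ h2.ne']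

/-- The maximal likelihoods of all strings of length `k` add up to at most the number of
types. -/
theorem sum_prod_empirical_le {k : ℕ} (hk : 0 < k) :
    ∑ x : Fin k → X, ∏ i, empirical x (x i) ≤ ((k : ℝ) + 1) ^ Fintype.card X := by
  -- A type is determined by the counts of the letters, each in `{0, …, k}`, so there are at most
  -- `(k+1)^|X|` of them.
  let count : (Fin k → X) → X → Fin (k + 1) := fun x a =>
    ⟨(Finset.univ.filter fun i => x i = a).card,
      Nat.lt_succ_of_le ((Finset.card_le_univ _).trans (by simp))⟩
  have hcount : ∀ x a, empirical x a = ((count x a : ℕ) : ℝ) / k := by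
    intro x a
    simp [empirical, count, Finset.sum_boole]
  rw [← Finset.sum_fiberwise (s := Finset.univ) (g := count)]
  have hcell : ∀ c : X → Fin (k + 1),
      ∑ x ∈ Finset.univ.filter (fun x => count x = c), ∏ i, empirical x (x i) ≤ 1 := by
    intro c
    by_cases hne : ∃ x, count x = c
    · obtain ⟨x₀, rfl⟩ := hne
      -- All strings of one type have the same empirical law, so the sum is the probability of the
      -- type class under a single product law.
      calc ∑ x ∈ Finset.univ.filter (fun x => count x = count x₀), ∏ i, empirical x (x i)
          = ∑ x ∈ Finset.univ.filter (fun x => count x = count x₀),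
              ∏ i, empirical x₀ (x i) := by
            refine Finset.sum_congr rfl fun x hx => Finset.prod_congr rfl fun i _ => ?_
            rw [hcount, hcount, (Finset.mem_filter.1 hx).2]
        _ ≤ ∑ x : Fin k → X, ∏ i, empirical x₀ (x i) :=
            Finset.sum_le_sum_of_subset_of_nonneg (Finset.filter_subset _ _) fun x _ _ =>
              Finset.prod_nonneg fun i _ => empirical_nonneg _ _
        _ = ∏ _i : Fin k, ∑ a, empirical x₀ a := by
            rw [Finset.prod_univ_sum, Fintype.piFinset_univ]
        _ = 1 := by simp [(empirical_mem_stdSimplex hk x₀).2]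
    · push Not at hne
      simp [hne]
  refine (Finset.sum_le_sum fun c _ => hcell c).trans ?_
  simp

variable {M : ℕ}

theorem sum_prod_prod_empirical_le {k : ℕ} (hk : 0 < k) :
    ∑ x : Fin k → Fin M → X, ∏ j, ∏ i, empirical (fun i => x i j) (x i j) ≤
      ((k : ℝ) + 1) ^ (M * Fintype.card X) := by
  rw [← (Equiv.piComm fun (_ : Fin M) (_ : Fin k) => X).sum_comp]
  have h := Finset.prod_univ_sum (ι := Fin M) (fun _ => (Finset.univ : Finset (Fin k → X)))
    fun _ x => ∏ i, empirical x (x i)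
  rw [Fintype.piFinset_univ] at h
  refine (le_of_eq h.symm).trans ?_
  rw [Finset.prod_const, Finset.card_univ, Fintype.card_fin, mul_comm M, pow_mul]
  refine pow_le_pow_left₀ (Finset.sum_nonneg fun x _ => Finset.prod_nonneg fun i _ =>
    empirical_nonneg _ _) (sum_prod_empirical_le hk) M

/-- Sanov's bound for the types of `M` independent strings. -/
theorem measureReal_pathPrefix_le_exp_mul [MeasurableSpace X] [MeasurableSingletonClass X]
    (P : Fin M → PMF X) {k : ℕ} (hk : 0 < k) (S : Set (Fin k → Fin M → X)) (d : ℝ)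
    (hS : ∀ x ∈ S, (∀ i j, P j (x i j) ≠ 0) →
      d ≤ ∑ j, relEntropy (empirical fun i => x i j) fun a => (P j a).toReal) :
    (Measure.infinitePi fun _ : ℕ => symbolLaw P).real (pathPrefix k ⁻¹' S) ≤
      Real.exp (-k * d) * ((k : ℝ) + 1) ^ (M * Fintype.card X) := by
  classical
  rw [measureReal_pathPrefix]
  refine le_trans ?_ (mul_le_mul_of_nonneg_left (sum_prod_prod_empirical_le (X := X) hk)
    (Real.exp_nonneg _))
  rw [Finset.mul_sum]
  refine Finset.sum_le_sum fun x _ => ?_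
  have hnn : 0 ≤ ∏ j, ∏ i, empirical (fun i => x i j) (x i j) :=
    Finset.prod_nonneg fun j _ => Finset.prod_nonneg fun i _ => empirical_nonneg _ _
  have hnn' := mul_nonneg (Real.exp_nonneg (-k * d)) hnn
  by_cases hx : x ∈ S
  · rw [Set.indicator_of_mem hx, Pi.one_apply, mul_one]
    simp_rw [symbolLaw_real_singleton]
    rw [Finset.prod_comm]
    -- Strings of probability zero are treated apart: there `log (p / 0) = 0` makes `relEntropy`
    -- smaller than the true, infinite divergence.
    by_cases h0 : ∀ i j, P j (x i j) ≠ 0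
    · have h1 : ∀ j, ∏ i, (P j (x i j)).toReal = Real.exp (-k * relEntropy
          (empirical fun i => x i j) fun a => (P j a).toReal) *
            ∏ i, empirical (fun i => x i j) (x i j) := fun j =>
        prod_apply_eq_exp_mul (P := fun a => (P j a).toReal) (fun i => x i j) fun i =>
          ENNReal.toReal_pos (h0 i j) ((P j).apply_ne_top _)
      rw [Finset.prod_congr rfl fun j _ => h1 j, Finset.prod_mul_distrib, ← Real.exp_sum,
        ← Finset.mul_sum]
      refine mul_le_mul_of_nonneg_right (Real.exp_le_exp.2 ?_) hnn
      have hk' : (0 : ℝ) ≤ k := Nat.cast_nonneg k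
      have := hS x hx h0
      nlinarith
    · push Not at h0
      obtain ⟨i, j, hij⟩ := h0
      rw [Finset.prod_eq_zero (Finset.mem_univ j)
        (Finset.prod_eq_zero (Finset.mem_univ i) (by simp [hij]))]
      exact hnn'
  · rw [Set.indicator_of_notMem hx, mul_zero]
    exact hnn'

end Types

theorem outlierSet_nonempty {M T : ℕ} (hT : 0 < T) (B : OutlierSet M T) : B.1.Nonempty :=
  Finset.card_pos.1 (by rw [B.2]; exact hT)

theorem outlierSet_card_compl {M T : ℕ} (B : OutlierSet M T) : (B.1ᶜ).card = M - T := by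
  rw [Finset.card_compl, Fintype.card_fin, B.2]

theorem outlierSet_compl_nonempty {M T : ℕ} (hTM : 2 * T < M) (B : OutlierSet M T) :
    (B.1ᶜ).Nonempty :=
  Finset.card_pos.1 (by rw [outlierSet_card_compl]; omega)

/-! ### The expected stopping time of the sequential test. -/

section StoppingTime

variable {X : Type*} [Fintype X] [DecidableEq X] {M T : ℕ}

theorem score_le_sum_relEntropy (hT : 0 < T) (hTM : 2 * T < M) (PN PA : PMF X)
    (B : OutlierSet M T) {k : ℕ} (hk : 0 < k) (x : Fin k → Fin M → X)
    (hx : ∀ i j, hypPMF PN PA B j (x i j) ≠ 0) :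
    score B x ≤
      ∑ j, relEntropy (empirical fun i => x i j) fun a => (hypPMF PN PA B j a).toReal := by
  have hQ : ∀ j, (empirical fun i => x i j) ∈ stdSimplex ℝ X := fun j =>
    empirical_mem_stdSimplex hk _
  have habs : ∀ j a, (empirical fun i => x i j) a ≠ 0 →
      (hypPMF PN PA B j a).toReal ≠ 0 := by
    intro j a ha
    obtain ⟨i, rfl⟩ := exists_of_empirical_ne_zero ha
    exact (ENNReal.toReal_pos (hx i j) ((hypPMF PN PA B j).apply_ne_top _)).ne'
  have hA : ∀ j ∈ B.1, hypPMF PN PA B j = PA := fun j hj => if_pos hj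
  have hN : ∀ j ∈ B.1ᶜ, hypPMF PN PA B j = PN := fun j hj => if_neg (Finset.mem_compl.1 hj)
  rw [← Finset.sum_compl_add_sum B.1]
  refine add_le_add ?_ ?_
  · refine (sum_relEntropy_groupMean_le (outlierSet_compl_nonempty hTM B) hQ
      (toReal_mem_stdSimplex PN) fun j hj a ha => ?_).trans
        (le_of_eq (Finset.sum_congr rfl fun j hj => by rw [hN j hj]))
    have := habs j a ha
    rwa [hN j hj] at this
  · refine (sum_relEntropy_groupMean_le (outlierSet_nonempty hT B) hQ
      (toReal_mem_stdSimplex PA) fun j hj a ha => ?_).trans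
        (le_of_eq (Finset.sum_congr rfl fun j hj => by rw [hA j hj]))
    have := habs j a ha
    rwa [hA j hj] at this

theorem threshold_lt_score_of_lt_seqStopTime {n k : ℕ} {ω : Path X M} (hnk : n - 1 ≤ k)
    (hk : (k : ℕ∞) < seqStopTime M T n ω) (C : OutlierSet M T) :
    threshold X M k < score C (pathPrefix k ω) := by
  by_contra! h
  exact absurd (iInf₂_le (f := fun (k : ℕ) (_ : k ∈ stopTimes M T n ω) => (k : ℕ∞)) k
    ⟨hnk, C, h⟩) (not_le.2 hk)

/-- At every time from `n - 1` on at which the test continues, in particular the score of `B`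
exceeds the threshold. Hence the delay beyond `n - 1` is at most the number of such times. -/
theorem seqStopTime_le_add_tsum (n : ℕ) (B : OutlierSet M T) (ω : Path X M) :
    (seqStopTime M T n ω : ℝ≥0∞) ≤ ((n - 1 : ℕ) : ℝ≥0∞) + ∑' i : ℕ,
      {ω' : Path X M | threshold X M (n - 1 + i) <
        score B (pathPrefix (n - 1 + i) ω')}.indicator (fun _ => (1 : ℝ≥0∞)) ω := by
  have key : ∀ m : ℕ, (m : ℕ∞) ≤ seqStopTime M T n ω →
      (m : ℝ≥0∞) ≤ ((n - 1 : ℕ) : ℝ≥0∞) + ∑' i : ℕ,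
      {ω' : Path X M | threshold X M (n - 1 + i) <
        score B (pathPrefix (n - 1 + i) ω')}.indicator (fun _ => (1 : ℝ≥0∞)) ω := by
    intro m hm
    rcases le_total m (n - 1) with h | h
    · exact le_add_right (by exact_mod_cast h)
    · obtain ⟨l, rfl⟩ := Nat.exists_eq_add_of_le h
      rw [Nat.cast_add]
      refine add_le_add le_rfl (le_trans (le_of_eq ?_) (ENNReal.sum_le_tsum (Finset.range l)))
      rw [Finset.sum_congr rfl fun i hi => Set.indicator_of_mem ?_ _]
      · simp
      · refine threshold_lt_score_of_lt_seqStopTime (Nat.le_add_right _ _)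
          (lt_of_lt_of_le ?_ hm) B
        have := Finset.mem_range.1 hi
        exact_mod_cast (by omega : n - 1 + i < n - 1 + l)
  rcases h : seqStopTime M T n ω with _ | m
  · have htop : ∀ m : ℕ, (m : ℕ∞) ≤ seqStopTime M T n ω := fun m => by
      rw [h]
      exact le_top
    rw [ENNReal.eq_top_of_forall_nnreal_le (x := _ + _) fun r => ?_]
    · exact le_top
    · obtain ⟨m, hm⟩ := exists_nat_ge r
      exact le_trans (by exact_mod_cast hm) (key m (htop m))
  · exact key m (le_of_eq h.symm)

variable [MeasurableSpace X] [MeasurableSingletonClass X]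

/-- Here the constant in the threshold is decisive: of the exponent `(M + 1)|X|`, the part `M|X|`
cancels the number of types, and the remaining `|X|` is at least `2` for a nontrivial alphabet,
which makes the bound summable. -/
theorem hypLaw_threshold_lt_score_le [Nontrivial X] (hT : 0 < T) (hTM : 2 * T < M)
    (PN PA : PMF X) (B : OutlierSet M T) {k : ℕ} (hk : 0 < k) :
    hypLaw PN PA B {ω | threshold X M k < score B (pathPrefix k ω)} ≤
      ENNReal.ofReal (1 / ((k : ℝ) + 1) ^ 2) := by
  rw [← ofReal_measureReal]
  refine ENNReal.ofReal_le_ofReal ?_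
  refine (measureReal_pathPrefix_le_exp_mul (hypPMF PN PA B) hk
    {x | threshold X M k < score B x} (threshold X M k) fun x hx h0 =>
      (le_of_lt hx).trans (score_le_sum_relEntropy hT hTM PN PA B hk x h0)).trans ?_
  have hk' : (k : ℝ) ≠ 0 := by exact_mod_cast hk.ne'
  have hk1 : (0 : ℝ) < (k : ℝ) + 1 := by positivity
  have h1 : Real.exp (-k * threshold X M k) =
      (((k : ℝ) + 1) ^ ((M + 1) * Fintype.card X))⁻¹ := by
    have : -(k : ℝ) * threshold X M k =
        -((((M + 1) * Fintype.card X : ℕ) : ℝ) * Real.log ((k : ℝ) + 1)) := by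
      unfold threshold
      push_cast
      field_simp
    rw [this, Real.exp_neg, ← Real.log_pow, Real.exp_log (by positivity)]
  rw [h1, Nat.add_mul, one_mul, pow_add, mul_inv, one_div]
  have h2 : (((k : ℝ) + 1) ^ (M * Fintype.card X))⁻¹ * (((k : ℝ) + 1) ^ Fintype.card X)⁻¹ *
      ((k : ℝ) + 1) ^ (M * Fintype.card X) = (((k : ℝ) + 1) ^ Fintype.card X)⁻¹ := by
    field_simp
  rw [h2]
  refine inv_anti₀ (by positivity) (pow_le_pow_right₀ (by linarith [Nat.cast_nonneg (α := ℝ) k]) ?_)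
  exact Fintype.one_lt_card

/-- Telescoping, by `1/(s+1)^2 ≤ 1/s - 1/(s+1)`; the total is at most `1/N`. -/
theorem tsum_ofReal_one_div_sq_le {N : ℕ} (hN : 1 ≤ N) :
    ∑' i : ℕ, ENNReal.ofReal (1 / (((N + i : ℕ) : ℝ) + 1) ^ 2) ≤ 1 := by
  have hN' : (1 : ℝ) ≤ N := by exact_mod_cast hN
  refine ENNReal.tsum_le_of_sum_range_le fun l => ?_
  rw [← ENNReal.ofReal_sum_of_nonneg fun i _ => by positivity]
  refine ENNReal.ofReal_le_one.2 ?_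
  have h : ∀ l : ℕ, ∑ i ∈ Finset.range l, 1 / (((N + i : ℕ) : ℝ) + 1) ^ 2 ≤
      1 / (N : ℝ) - 1 / ((N + l : ℕ) : ℝ) := by
    intro l
    induction l with
    | zero => simp
    | succ l ih =>
      rw [Finset.sum_range_succ]
      have hpos : (0 : ℝ) < ((N + l : ℕ) : ℝ) := by
        push_cast
        positivity
      have h2 : 1 / (((N + l : ℕ) : ℝ) + 1) ^ 2 ≤
          1 / ((N + l : ℕ) : ℝ) - 1 / ((N + (l + 1) : ℕ) : ℝ) := by
        have h3 : ((N + (l + 1) : ℕ) : ℝ) = ((N + l : ℕ) : ℝ) + 1 := by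
          push_cast
          ring
        rw [h3]
        generalize ((N + l : ℕ) : ℝ) = s at hpos
        rw [div_sub_div _ _ hpos.ne' (by positivity), div_le_div_iff₀ (by positivity)
          (by positivity)]
        nlinarith
      linarith
  have h1 : 1 / (N : ℝ) ≤ 1 := by
    rw [div_le_one (by linarith)]
    exact hN'
  have h2 : (0 : ℝ) ≤ 1 / ((N + l : ℕ) : ℝ) := by positivity
  linarith [h l]

theorem satisfiesEST_seqTest [Nontrivial X] (hT : 0 < T) (hTM : 2 * T < M) {n : ℕ} (hn : 2 ≤ n)
    (φ : (k : ℕ) → (Fin k → Fin M → X) → OutlierSet M T) : SatisfiesEST (seqTest n φ) n := by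
  intro PN PA B
  have hmeas : ∀ i : ℕ, MeasurableSet {ω : Path X M | threshold X M (n - 1 + i) <
      score B (pathPrefix (n - 1 + i) ω)} := fun i =>
    measurable_pathPrefix (n - 1 + i)
      (Set.toFinite {x | threshold X M (n - 1 + i) < score B x}).measurableSet
  refine (lintegral_mono fun ω => seqStopTime_le_add_tsum n B ω).trans ?_
  rw [lintegral_add_left measurable_const, lintegral_const, measure_univ, mul_one,
    lintegral_tsum fun i => (measurable_const.indicator (hmeas i)).aemeasurable]
  simp_rw [lintegral_indicator_const (hmeas _), one_mul]
  refine (add_le_add le_rfl ((ENNReal.tsum_le_tsum fun i =>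
    hypLaw_threshold_lt_score_le hT hTM PN PA B (by omega)).trans
      (tsum_ofReal_one_div_sq_le (by omega)))).trans ?_
  exact_mod_cast (by omega : n - 1 + 1 ≤ n)

theorem hypLaw_seqStopTime_eq_top [Nontrivial X] (hT : 0 < T) (hTM : 2 * T < M)
    (PN PA : PMF X) (B : OutlierSet M T) (n : ℕ) :
    hypLaw PN PA B {ω | seqStopTime M T n ω = ⊤} = 0 := by
  have hlim : Tendsto (fun k : ℕ => ENNReal.ofReal (1 / ((k : ℝ) + 1) ^ 2)) atTop (𝓝 0) := by
    rw [← ENNReal.ofReal_zero]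
    refine ENNReal.tendsto_ofReal ?_
    have := (tendsto_one_div_add_atTop_nhds_zero_nat (𝕜 := ℝ)).pow 2
    simpa [div_pow] using this
  refine le_antisymm (ge_of_tendsto hlim ?_) bot_le
  filter_upwards [eventually_ge_atTop (n - 1), eventually_gt_atTop 0] with k hk hk0
  refine (measure_mono fun ω hω => ?_).trans (hypLaw_threshold_lt_score_le hT hTM PN PA B hk0)
  refine threshold_lt_score_of_lt_seqStopTime hk ?_ B
  rw [show seqStopTime M T n ω = ⊤ from hω]
  exact ENat.natCast_lt_top k

end StoppingTime

/-! ### The exponent `LD` in terms of affinities. -/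

section Exponent

variable {X : Type*} [Fintype X]

theorem ofReal_sum_rpow_mul_rpow (P Q : PMF X) {α β : ℝ} (hα : 0 ≤ α) (hβ : 0 ≤ β) :
    ENNReal.ofReal (∑ a, (P a).toReal ^ α * (Q a).toReal ^ β) = ∑ a, P a ^ α * Q a ^ β := by
  rw [ENNReal.ofReal_sum_of_nonneg fun a _ => by positivity]
  refine Finset.sum_congr rfl fun a _ => ?_
  rw [ENNReal.toReal_rpow, ENNReal.toReal_rpow, ← ENNReal.toReal_mul, ENNReal.ofReal_toReal]
  exact ENNReal.mul_ne_top (ENNReal.rpow_ne_top_of_nonneg hα (P.apply_ne_top a))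
    (ENNReal.rpow_ne_top_of_nonneg hβ (Q.apply_ne_top a))

theorem sum_rpow_mul_rpow_nonneg (P Q : PMF X) (α β : ℝ) :
    0 ≤ ∑ a, (P a).toReal ^ α * (Q a).toReal ^ β :=
  Finset.sum_nonneg fun _ _ => by positivity

/-- The order `1 - α` is carried as a separate `β` so that the sum takes literally the form of the
affinities below. -/
theorem renyiDiv_eq_coe (P Q : PMF X) {α β : ℝ} (hα : 0 ≤ α) (hβ : 0 < β) (hαβ : 1 - α = β)
    (h : ∑ a, (P a).toReal ^ α * (Q a).toReal ^ β ≠ 0) :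
    renyiDiv α P Q =
      ((-(1 / β) * Real.log (∑ a, (P a).toReal ^ α * (Q a).toReal ^ β) : ℝ) : EReal) := by
  have hc : 1 / (α - 1) = -(1 / β) := by rw [← hαβ, ← one_div_neg_eq_neg_one_div, neg_sub]
  unfold renyiDiv
  rw [hαβ, hc, ← ofReal_sum_rpow_mul_rpow P Q hα hβ.le, ENNReal.log_ofReal_of_pos
    (lt_of_le_of_ne (sum_rpow_mul_rpow_nonneg P Q α β) h.symm), ← EReal.coe_mul]

theorem renyiDiv_eq_top (P Q : PMF X) {α β : ℝ} (hα : 0 ≤ α) (hβ : 0 < β) (hαβ : 1 - α = β)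
    (h : ∑ a, (P a).toReal ^ α * (Q a).toReal ^ β = 0) : renyiDiv α P Q = ⊤ := by
  have hc : 1 / (α - 1) < 0 := one_div_neg.2 (by linarith)
  unfold renyiDiv
  rw [hαβ, ← ofReal_sum_rpow_mul_rpow P Q hα hβ.le, h, ENNReal.ofReal_zero, ENNReal.log_zero,
    EReal.coe_mul_bot_of_neg hc]

/-- The total mass of the geometric mean of the laws, with `t` copies of `PA` and `T - t` copies
of `PN`. -/
noncomputable def outlierAffinity (PN PA : PMF X) (T t : ℕ) : ℝ :=
  ∑ a, (PA a).toReal ^ ((t : ℝ) / T) * (PN a).toReal ^ (((T : ℝ) - t) / T)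

/-- The total mass of the geometric mean of the laws, with `M - 2 T + t` copies of `PN` and
`T - t` copies of `PA`. -/
noncomputable def nominalAffinity (PN PA : PMF X) (M T t : ℕ) : ℝ :=
  ∑ a, (PN a).toReal ^ (((M : ℝ) - 2 * T + t) / ((M : ℝ) - T)) *
    (PA a).toReal ^ (((T : ℝ) - t) / ((M : ℝ) - T))

/-- The term with index `t` in the minimum that defines `LD`, as a real number. -/
noncomputable def overlapExponent (PN PA : PMF X) (M T t : ℕ) : ℝ :=
  -T * Real.log (outlierAffinity PN PA T t) -
    ((M : ℝ) - T) * Real.log (nominalAffinity PN PA M T t)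

variable {M T t : ℕ}

/-- The term with index `t` in the minimum that defines `LD`. -/
noncomputable def overlapTerm (PN PA : PMF X) (M T t : ℕ) : EReal :=
  (((T : ℝ) - (t : ℝ) : ℝ) : EReal) *
    (renyiDiv ((t : ℝ) / (T : ℝ)) PA PN +
      renyiDiv (((M : ℝ) - 2 * (T : ℝ) + (t : ℝ)) / ((M : ℝ) - (T : ℝ))) PN PA)

theorem LD_le_overlapTerm (PN PA : PMF X) (ht : t < T) : LD PN PA M T ≤ overlapTerm PN PA M T t :=
  iInf_le (fun t : Fin T => overlapTerm PN PA M T t) ⟨t, ht⟩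

theorem le_LD_of_forall_le_overlapTerm (PN PA : PMF X) {E : EReal}
    (h : ∀ t < T, E ≤ overlapTerm PN PA M T t) : E ≤ LD PN PA M T :=
  le_iInf fun t => h t t.2

theorem overlapTerm_eq_coe (PN PA : PMF X) (hTM : 2 * T < M) (ht : t < T)
    (hV : outlierAffinity PN PA T t ≠ 0) (hW : nominalAffinity PN PA M T t ≠ 0) :
    overlapTerm PN PA M T t = (overlapExponent PN PA M T t : EReal) := by
  have ht' : (t : ℝ) < T := by exact_mod_cast ht
  have ht0 : (0 : ℝ) ≤ t := Nat.cast_nonneg t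
  have hM' : 2 * (T : ℝ) < M := by exact_mod_cast hTM
  have h1 : (0 : ℝ) < T - t := by linarith
  have h2 : (0 : ℝ) < T := by linarith
  have h3 : (0 : ℝ) < M - T := by linarith
  have h4 : (0 : ℝ) ≤ M - 2 * T + t := by linarith
  unfold overlapTerm
  rw [renyiDiv_eq_coe PA PN (β := ((T : ℝ) - t) / T) (by positivity) (by positivity)
      (by field_simp) hV,
    renyiDiv_eq_coe PN PA (β := ((T : ℝ) - t) / ((M : ℝ) - T)) (by positivity) (by positivity)
      (by field_simp; ring) hW, ← EReal.coe_add, ← EReal.coe_mul]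
  congr 1
  unfold overlapExponent outlierAffinity nominalAffinity
  field_simp
  ring

theorem overlapTerm_eq_top (PN PA : PMF X) (hTM : 2 * T < M) (ht : t < T)
    (h : outlierAffinity PN PA T t = 0 ∨ nominalAffinity PN PA M T t = 0) :
    overlapTerm PN PA M T t = ⊤ := by
  have ht' : (t : ℝ) < T := by exact_mod_cast ht
  have ht0 : (0 : ℝ) ≤ t := Nat.cast_nonneg t
  have hM' : 2 * (T : ℝ) < M := by exact_mod_cast hTM
  have h1 : (0 : ℝ) < T - t := by linarith
  have h2 : (0 : ℝ) < T := by linarith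
  have h3 : (0 : ℝ) < M - T := by linarith
  have h4 : (0 : ℝ) ≤ M - 2 * T + t := by linarith
  have e1 := renyiDiv_eq_coe PA PN (α := (t : ℝ) / T) (β := ((T : ℝ) - t) / T) (by positivity)
    (by positivity) (by field_simp)
  have e2 := renyiDiv_eq_coe PN PA (α := ((M : ℝ) - 2 * T + t) / ((M : ℝ) - T))
    (β := ((T : ℝ) - t) / ((M : ℝ) - T)) (by positivity) (by positivity) (by field_simp; ring)
  have f1 := renyiDiv_eq_top PA PN (α := (t : ℝ) / T) (β := ((T : ℝ) - t) / T) (by positivity)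
    (by positivity) (by field_simp)
  have f2 := renyiDiv_eq_top PN PA (α := ((M : ℝ) - 2 * T + t) / ((M : ℝ) - T))
    (β := ((T : ℝ) - t) / ((M : ℝ) - T)) (by positivity) (by positivity) (by field_simp; ring)
  have hsum : renyiDiv ((t : ℝ) / (T : ℝ)) PA PN +
      renyiDiv (((M : ℝ) - 2 * (T : ℝ) + (t : ℝ)) / ((M : ℝ) - (T : ℝ))) PN PA = ⊤ := by
    rcases h with h | h
    · rw [f1 h]
      by_cases hW : nominalAffinity PN PA M T t = 0
      · rw [f2 hW, EReal.top_add_top]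
      · rw [e2 hW, EReal.top_add_coe]
    · rw [f2 h]
      by_cases hV : outlierAffinity PN PA T t = 0
      · rw [f1 hV, EReal.top_add_top]
      · rw [e1 hV, EReal.coe_add_top]
  unfold overlapTerm
  rw [hsum, EReal.coe_mul_top_of_pos h1]

/-! ### Sizes of the intersections of two outlier sets. -/

section Overlap

variable {B C : OutlierSet M T}

theorem card_inter_lt_of_ne (hCB : C ≠ B) : (C.1 ∩ B.1).card < T := by
  refine lt_of_lt_of_eq (Finset.card_lt_card ⟨Finset.inter_subset_left, fun h => hCB (Subtype.ext ?_)⟩) C.2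
  exact Finset.eq_of_subset_of_card_le (h.trans Finset.inter_subset_right) (by rw [B.2, C.2])

theorem sum_relEntropy_hypPMF (PN PA : PMF X) (B : OutlierSet M T) (D : Finset (Fin M))
    (V : X → ℝ) :
    ∑ j ∈ D, relEntropy V (fun a => (hypPMF PN PA B j a).toReal) =
      (D ∩ B.1).card * relEntropy V (fun a => (PA a).toReal) +
        (D \ B.1).card * relEntropy V (fun a => (PN a).toReal) := by
  have h : ∀ j, relEntropy V (fun a => (hypPMF PN PA B j a).toReal) =
      if j ∈ B.1 then relEntropy V (fun a => (PA a).toReal) else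
        relEntropy V (fun a => (PN a).toReal) := by
    intro j
    unfold hypPMF
    split_ifs <;> rfl
  rw [Finset.sum_congr rfl fun j _ => h j, Finset.sum_ite, Finset.filter_mem_eq_inter,
    Finset.filter_notMem_eq_sdiff]
  simp

theorem card_sdiff_cast (ht : (C.1 ∩ B.1).card = t) : ((C.1 \ B.1).card : ℝ) = T - t := by
  have h := Finset.card_inter_add_card_sdiff C.1 B.1
  rw [C.2, ht] at h
  have h' : (t : ℝ) + (C.1 \ B.1).card = T := by exact_mod_cast h
  linarith

theorem card_compl_inter_cast (ht : (C.1 ∩ B.1).card = t) :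
    ((C.1ᶜ ∩ B.1).card : ℝ) = T - t := by
  have h := Finset.card_inter_add_card_sdiff B.1 C.1
  rw [B.2, Finset.inter_comm, ht] at h
  have h' : (t : ℝ) + (B.1 \ C.1).card = T := by exact_mod_cast h
  rw [Finset.inter_comm C.1ᶜ, ← Finset.sdiff_eq_inter_compl]
  linarith

theorem card_compl_sdiff_cast (ht : (C.1 ∩ B.1).card = t) :
    ((C.1ᶜ \ B.1).card : ℝ) = M - 2 * T + t := by
  have h := Finset.card_inter_add_card_sdiff C.1ᶜ B.1
  have h2 := C.1.card_compl_add_card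
  rw [Fintype.card_fin, C.2] at h2
  have h3 := card_compl_inter_cast ht
  have h4 : ((C.1ᶜ ∩ B.1).card : ℝ) + (C.1ᶜ \ B.1).card + T = M := by
    exact_mod_cast (by omega : (C.1ᶜ ∩ B.1).card + (C.1ᶜ \ B.1).card + T = M)
  linarith

end Overlap

end Exponent

theorem tendsto_log_add_one_div :
    Tendsto (fun k : ℕ => Real.log ((k : ℝ) + 1) / k) atTop (𝓝 0) := by
  have h1 : Tendsto (fun k : ℕ => Real.log ((k : ℝ) + 1) / ((k : ℝ) + 1)) atTop (𝓝 0) := by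
    have h := (Real.isLittleO_log_id_atTop.tendsto_div_nhds_zero).comp
      (tendsto_atTop_add_const_right atTop (1 : ℝ) tendsto_natCast_atTop_atTop)
    exact h
  have h2 : Tendsto (fun k : ℕ => 2 * (Real.log ((k : ℝ) + 1) / ((k : ℝ) + 1))) atTop (𝓝 0) := by
    simpa using h1.const_mul 2
  refine tendsto_of_tendsto_of_tendsto_of_le_of_le' tendsto_const_nhds h2 ?_ ?_
  · exact Eventually.of_forall fun k =>
      div_nonneg (Real.log_nonneg (by linarith [Nat.cast_nonneg (α := ℝ) k])) (Nat.cast_nonneg _)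
  · filter_upwards [eventually_ge_atTop 1] with k hk
    have hk' : (1 : ℝ) ≤ k := by exact_mod_cast hk
    have hlog : 0 ≤ Real.log ((k : ℝ) + 1) := Real.log_nonneg (by linarith)
    rw [← mul_div_assoc, div_le_div_iff₀ (by linarith) (by linarith)]
    nlinarith

theorem tendsto_threshold {X : Type*} [Fintype X] {M : ℕ} : Tendsto (fun k : ℕ => threshold X M k) atTop (𝓝 0) := by
  have h := tendsto_log_add_one_div.const_mul (((M : ℝ) + 1) * Fintype.card X)
  rw [mul_zero] at h
  refine h.congr fun k => ?_
  unfold threshold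
  ring

/-! ### The error exponent of the sequential test. -/

section Achievability

variable {X : Type*} [Fintype X] [DecidableEq X] {M T : ℕ}

/-- A score of at most `f` bounds every single divergence from the group mean by `f`, so each type
may be replaced by its mean at a cost of order `√f * L`. What remains are weighted divergences of
two means from `PA` and `PN`, bounded below by their geometric means. -/
theorem overlapExponent_sub_le (hT : 0 < T) (hTM : 2 * T < M) {PN PA : PMF X}
    (hN : ∀ x, PN x ≠ 0) (hA : ∀ x, PA x ≠ 0) {B C : OutlierSet M T} {t : ℕ}
    (ht : (C.1 ∩ B.1).card = t) {L : ℝ} (hLN : ∀ x, |Real.log (PN x).toReal| ≤ L)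
    (hLA : ∀ x, |Real.log (PA x).toReal| ≤ L) {k : ℕ} (hk : 0 < k) (x : Fin k → Fin M → X)
    {f : ℝ} (hf : score C x ≤ f) :
    overlapExponent PN PA M T t - M * Fintype.card X * (2 * √f * L) ≤
      ∑ j, relEntropy (empirical fun i => x i j) fun a => (hypPMF PN PA B j a).toReal := by
  have hM' : 2 * (T : ℝ) < M := by exact_mod_cast hTM
  have hT' : (0 : ℝ) < T := by exact_mod_cast hT
  have hN' : ∀ a, 0 < (PN a).toReal := fun a => ENNReal.toReal_pos (hN a) (PN.apply_ne_top a)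
  have hA' : ∀ a, 0 < (PA a).toReal := fun a => ENNReal.toReal_pos (hA a) (PA.apply_ne_top a)
  set Q : Fin M → X → ℝ := fun j => empirical fun i => x i j with hQdef
  have hQ : ∀ j, Q j ∈ stdSimplex ℝ X := fun j => empirical_mem_stdSimplex hk _
  have hP : ∀ j a, (hypPMF PN PA B j a).toReal ≠ 0 := by
    intro j a
    unfold hypPMF
    split_ifs
    · exact (hA' a).ne'
    · exact (hN' a).ne'
  have hL : ∀ j a, |Real.log (hypPMF PN PA B j a).toReal| ≤ L := by
    intro j a
    unfold hypPMF
    split_ifs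
    · exact hLA a
    · exact hLN a
  have hCne := outlierSet_nonempty hT C
  have hCcne := outlierSet_compl_nonempty hTM C
  have hnn : ∀ D : Finset (Fin M), D.Nonempty → ∀ j ∈ D,
      0 ≤ relEntropy (Q j) (groupMean D Q) := fun D hD j hj =>
    relEntropy_nonneg (hQ j) (groupMean_mem_stdSimplex hD hQ) fun a ha =>
      groupMean_ne_zero hQ hj ha
  have hs : ∑ j ∈ C.1ᶜ, relEntropy (Q j) (groupMean C.1ᶜ Q) +
      ∑ j ∈ C.1, relEntropy (Q j) (groupMean C.1 Q) ≤ f := hf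
  have hs1 := Finset.sum_nonneg (hnn _ hCne)
  have hs2 := Finset.sum_nonneg (hnn _ hCcne)
  have h1 := sum_relEntropy_groupMean_sub_le (P := fun j a => (hypPMF PN PA B j a).toReal)
    hCne hQ hP (f := f)
    (fun j hj => by linarith [Finset.single_le_sum (hnn _ hCne) hj]) hL
  have h2 := sum_relEntropy_groupMean_sub_le (P := fun j a => (hypPMF PN PA B j a).toReal)
    hCcne hQ hP (f := f)
    (fun j hj => by linarith [Finset.single_le_sum (hnn _ hCcne) hj]) hL
  rw [sum_relEntropy_hypPMF, ht, card_sdiff_cast ht, C.2] at h1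
  rw [sum_relEntropy_hypPMF, card_compl_inter_cast ht, card_compl_sdiff_cast ht] at h2
  -- The weights count the members of `C`, and then of its complement, that are outliers or nominal
  -- under `B`.
  have h3 := neg_mul_log_sum_rpow_le (groupMean_mem_stdSimplex hCne hQ) hA' hN'
    (u := t) (v := (T : ℝ) - t) hT' (by ring)
  have h4 := neg_mul_log_sum_rpow_le (groupMean_mem_stdSimplex hCcne hQ) hN' hA'
    (u := (M : ℝ) - 2 * T + t) (v := (T : ℝ) - t) (N := (M : ℝ) - T) (by linarith) (by ring)
  have h5 : ((C.1ᶜ).card : ℝ) = M - T := by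
    rw [outlierSet_card_compl, Nat.cast_sub (by omega)]
  rw [h5] at h2
  rw [← Finset.sum_compl_add_sum C.1]
  unfold overlapExponent outlierAffinity nominalAffinity
  linarith

theorem exists_mem_stopTimes {n : ℕ} {ω : Path X M} (h : seqStopTime M T n ω ≠ ⊤) :
    ∃ k ∈ stopTimes M T n ω, seqStopTime M T n ω = k := by
  have hne : (stopTimes M T n ω).Nonempty := by
    by_contra hempty
    rw [Set.not_nonempty_iff_eq_empty] at hempty
    exact h (by simp [seqStopTime, hempty])
  refine ⟨sInf (stopTimes M T n ω), Nat.sInf_mem hne, le_antisymm ?_ ?_⟩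
  · exact iInf₂_le (f := fun (k : ℕ) (_ : k ∈ stopTimes M T n ω) => (k : ℕ∞)) _ (Nat.sInf_mem hne)
  · exact le_iInf₂ fun k hk => by exact_mod_cast Nat.sInf_le hk

variable [MeasurableSpace X] [MeasurableSingletonClass X]

/-- Under `B`, a wrong score falls below the threshold at time `k` with a probability that decays
with any exponent below the one of the overlap. -/
theorem eventually_hypLaw_score_le_threshold (hT : 0 < T) (hTM : 2 * T < M) {PN PA : PMF X}
    (hN : ∀ x, PN x ≠ 0) (hA : ∀ x, PA x ≠ 0) {B C : OutlierSet M T} {t : ℕ}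
    (ht : (C.1 ∩ B.1).card = t) {E : ℝ} (hE : E < overlapExponent PN PA M T t) :
    ∀ᶠ k : ℕ in atTop, hypLaw PN PA B {ω | score C (pathPrefix k ω) ≤ threshold X M k} ≤
      ENNReal.ofReal (Real.exp (-(k : ℝ) * E)) := by
  set L : ℝ := ∑ x, (|Real.log (PN x).toReal| + |Real.log (PA x).toReal|) with hLdef
  have hterm : ∀ x, |Real.log (PN x).toReal| + |Real.log (PA x).toReal| ≤ L := fun x =>
    Finset.single_le_sum (f := fun x => |Real.log (PN x).toReal| + |Real.log (PA x).toReal|)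
      (fun y _ => by positivity) (Finset.mem_univ x)
  have hLN : ∀ x, |Real.log (PN x).toReal| ≤ L := fun x =>
    (le_add_of_nonneg_right (abs_nonneg _)).trans (hterm x)
  have hLA : ∀ x, |Real.log (PA x).toReal| ≤ L := fun x =>
    (le_add_of_nonneg_left (abs_nonneg _)).trans (hterm x)
  -- Two losses in the exponent vanish: the inhomogeneity within the groups and the number of types.
  have hlim : Tendsto (fun k : ℕ => M * Fintype.card X * (2 * √(threshold X M k) * L) +
      M * Fintype.card X * (Real.log ((k : ℝ) + 1) / k)) atTop (𝓝 0) := by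
    have h1 := ((((tendsto_threshold (X := X) (M := M)).sqrt).const_mul 2).mul_const L).const_mul
      ((M : ℝ) * Fintype.card X)
    have h2 := tendsto_log_add_one_div.const_mul ((M : ℝ) * Fintype.card X)
    simpa using h1.add h2
  filter_upwards [hlim.eventually (gt_mem_nhds (sub_pos.2 hE)), eventually_gt_atTop 0]
    with k hk hk0
  have hk' : (0 : ℝ) < k := by exact_mod_cast hk0
  rw [← ofReal_measureReal]
  refine ENNReal.ofReal_le_ofReal ?_
  refine (measureReal_pathPrefix_le_exp_mul (hypPMF PN PA B) hk0
    {x | score C x ≤ threshold X M k} _ fun x hx _ =>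
      overlapExponent_sub_le hT hTM hN hA ht hLN hLA hk0 x hx).trans ?_
  have h1 : ((k : ℝ) + 1) ^ (M * Fintype.card X) =
      Real.exp (k * (M * Fintype.card X * (Real.log ((k : ℝ) + 1) / k))) := by
    have : (k : ℝ) * (M * Fintype.card X * (Real.log ((k : ℝ) + 1) / k)) =
        ((M * Fintype.card X : ℕ) : ℝ) * Real.log ((k : ℝ) + 1) := by
      push_cast
      field_simp
    rw [this, ← Real.log_pow, Real.exp_log (by positivity)]
  rw [h1, ← Real.exp_add]
  refine Real.exp_le_exp.2 ?_
  nlinarith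

/-- If the test stops with a wrong decision, the minimality of its score puts that score below the
threshold as well, whichever set caused the stop. Never stopping is a null event. -/
theorem misclassProb_seqTest_le [Nontrivial X] (hT : 0 < T) (hTM : 2 * T < M) (PN PA : PMF X)
    (B : OutlierSet M T) {φ : (k : ℕ) → (Fin k → Fin M → X) → OutlierSet M T}
    (hφ : IsMinScoreRule φ) (n : ℕ) :
    misclassProb (seqTest n φ) PN PA B ≤
      ∑' i : ℕ, ∑ C ∈ Finset.univ.filter (fun C : OutlierSet M T => C ≠ B), hypLaw PN PA B
        {ω | score C (pathPrefix (n - 1 + i) ω) ≤ threshold X M (n - 1 + i)} := by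
  have hsub : {ω | ¬ ∃ k : ℕ, (seqTest n φ).τ ω = k ∧ (seqTest n φ).φ k (pathPrefix k ω) = B} ⊆
      {ω | seqStopTime M T n ω = ⊤} ∪
        ⋃ i : ℕ, ⋃ C ∈ Finset.univ.filter (fun C : OutlierSet M T => C ≠ B),
          {ω : Path X M | score C (pathPrefix (n - 1 + i) ω) ≤ threshold X M (n - 1 + i)} := by
    intro ω hω
    by_cases htop : seqStopTime M T n ω = ⊤
    · exact Or.inl htop
    · right
      obtain ⟨k, ⟨hk, C, hC⟩, hτ⟩ := exists_mem_stopTimes htop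
      obtain ⟨i, rfl⟩ := Nat.exists_eq_add_of_le hk
      have hne : φ (n - 1 + i) (pathPrefix (n - 1 + i) ω) ≠ B := fun hB => hω ⟨_, hτ, hB⟩
      simp only [Set.mem_iUnion, Finset.mem_filter, Finset.mem_univ, true_and]
      exact ⟨i, _, hne, (hφ _ _ C).trans hC⟩
  refine (measure_mono hsub).trans ((measure_union_le _ _).trans ?_)
  rw [hypLaw_seqStopTime_eq_top hT hTM, zero_add]
  refine (measure_iUnion_le _).trans (ENNReal.tsum_le_tsum fun i => ?_)
  exact measure_biUnion_finset_le _ _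

theorem coe_le_neg_log_div {r : ℝ} {n : ℕ} (hn : 0 < n) {p : ℝ≥0∞}
    (hp : p ≤ ENNReal.ofReal (Real.exp (-(n : ℝ) * r))) :
    (r : EReal) ≤ (-ENNReal.log p) / (n : EReal) := by
  rw [EReal.le_div_iff_mul_le (by exact_mod_cast hn) (EReal.natCast_ne_top n),
    EReal.le_neg]
  refine (ENNReal.log_le_log hp).trans (le_of_eq ?_)
  rw [ENNReal.log_ofReal_of_pos (Real.exp_pos _), Real.log_exp, ← EReal.coe_natCast,
    ← EReal.coe_mul, ← EReal.coe_neg]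
  congr 1
  ring

theorem LD_le_errorExponent_seqTest [Nontrivial X] (hT : 0 < T) (hTM : 2 * T < M) {PN PA : PMF X}
    (hN : ∀ x, PN x ≠ 0) (hA : ∀ x, PA x ≠ 0) (B : OutlierSet M T)
    {φ : ℕ → (k : ℕ) → (Fin k → Fin M → X) → OutlierSet M T}
    (hφ : ∀ n, IsMinScoreRule (φ n)) :
    LD PN PA M T ≤ errorExponent (fun n => seqTest n (φ n)) PN PA B := by
  refine EReal.ge_of_forall_gt_iff_ge.1 fun r hr => ?_
  refine le_liminf_of_le (by isBoundedDefault) ?_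
  rcases le_or_gt r 0 with hr0 | hr0
  · filter_upwards [eventually_gt_atTop 0] with n hn
    refine le_trans (by exact_mod_cast hr0) (coe_le_neg_log_div (r := 0) hn ?_)
    rw [mul_zero, Real.exp_zero, ENNReal.ofReal_one]
    exact prob_le_one
  obtain ⟨s, hrs, hsLD⟩ := EReal.lt_iff_exists_real_btwn.1 hr
  have hrs' : r < s := by exact_mod_cast hrs
  have hs0 : 0 < s := hr0.trans hrs'
  set 𝒞 := Finset.univ.filter fun C : OutlierSet M T => C ≠ B with h𝒞
  -- The rate `s` lies strictly between `r` and `LD`; the gap `s - r` later absorbs the constant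
  -- `c`.
  have hev : ∀ᶠ k : ℕ in atTop, ∀ C ∈ 𝒞,
      hypLaw PN PA B {ω | score C (pathPrefix k ω) ≤ threshold X M k} ≤
        ENNReal.ofReal (Real.exp (-(k : ℝ) * s)) := by
    rw [eventually_all_finset]
    intro C hC
    have hCB : C ≠ B := (Finset.mem_filter.1 hC).2
    refine eventually_hypLaw_score_le_threshold hT hTM hN hA rfl ?_
    have ht := card_inter_lt_of_ne hCB
    have hN' : ∀ a, 0 < (PN a).toReal := fun a => ENNReal.toReal_pos (hN a) (PN.apply_ne_top a)
    have hA' : ∀ a, 0 < (PA a).toReal := fun a => ENNReal.toReal_pos (hA a) (PA.apply_ne_top a)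
    have hlt := hsLD.trans_le (LD_le_overlapTerm PN PA ht)
    rw [overlapTerm_eq_coe PN PA hTM ht
      (Finset.sum_pos (fun a _ => mul_pos (Real.rpow_pos_of_pos (hA' a) _)
        (Real.rpow_pos_of_pos (hN' a) _)) Finset.univ_nonempty).ne'
      (Finset.sum_pos (fun a _ => mul_pos (Real.rpow_pos_of_pos (hN' a) _)
        (Real.rpow_pos_of_pos (hA' a) _)) Finset.univ_nonempty).ne'] at hlt
    exact_mod_cast hlt
  obtain ⟨K, hK⟩ := eventually_atTop.1 hev
  have hq : Real.exp (-s) < 1 := by simpa using hs0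
  -- The geometric series starts at `k = n - 1`, not at `n`, whence the factor `Real.exp s`.
  set c : ℝ := 𝒞.card * (Real.exp s * (1 - Real.exp (-s))⁻¹) with hc
  have hlim : Tendsto (fun n : ℕ => c * Real.exp (-(n : ℝ) * (s - r))) atTop (𝓝 0) := by
    have h1 : Tendsto (fun n : ℕ => (n : ℝ) * (s - r)) atTop atTop :=
      tendsto_natCast_atTop_atTop.atTop_mul_const (by linarith)
    have h2 := (Real.tendsto_exp_neg_atTop_nhds_zero.comp h1).const_mul c
    rw [mul_zero] at h2
    refine h2.congr fun n => ?_
    simp [neg_mul]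
  filter_upwards [eventually_gt_atTop 0, eventually_ge_atTop (K + 1),
    hlim.eventually (gt_mem_nhds one_pos)] with n hn hnK hn1
  refine coe_le_neg_log_div hn ?_
  refine (misclassProb_seqTest_le hT hTM PN PA B (hφ n) n).trans ?_
  have hgeo : HasSum (fun i : ℕ => (𝒞.card : ℝ) * Real.exp (-((n - 1 + i : ℕ) : ℝ) * s))
      (c * Real.exp (-(n : ℝ) * s)) := by
    have h1 := (hasSum_geometric_of_lt_one (Real.exp_nonneg (-s)) hq).mul_left
      ((𝒞.card : ℝ) * (Real.exp s * Real.exp (-(n : ℝ) * s)))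
    have h2 : 𝒞.card * (Real.exp s * Real.exp (-(n : ℝ) * s)) * (1 - Real.exp (-s))⁻¹ =
        c * Real.exp (-(n : ℝ) * s) := by
      rw [hc]
      ring
    rw [h2] at h1
    have h3 : (fun i : ℕ => (𝒞.card : ℝ) * Real.exp (-((n - 1 + i : ℕ) : ℝ) * s)) =
        fun i => 𝒞.card * (Real.exp s * Real.exp (-(n : ℝ) * s)) * Real.exp (-s) ^ i := by
      funext i
      rw [← Real.exp_add, mul_assoc, ← Real.exp_nat_mul, ← Real.exp_add, Nat.cast_add,
        Nat.cast_sub (by omega)]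
      congr 2
      push_cast
      ring
    rw [h3]
    exact h1
  have hstep : ∀ i : ℕ, ∑ C ∈ 𝒞, hypLaw PN PA B
      {ω | score C (pathPrefix (n - 1 + i) ω) ≤ threshold X M (n - 1 + i)} ≤
        ENNReal.ofReal ((𝒞.card : ℝ) * Real.exp (-((n - 1 + i : ℕ) : ℝ) * s)) := by
    intro i
    refine (Finset.sum_le_sum fun C hC => hK (n - 1 + i) (by omega) C hC).trans ?_
    rw [Finset.sum_const, nsmul_eq_mul, ENNReal.ofReal_mul (Nat.cast_nonneg _),
      ENNReal.ofReal_natCast]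
  refine (ENNReal.tsum_le_tsum hstep).trans ?_
  rw [← ENNReal.ofReal_tsum_of_nonneg (fun i => by positivity) hgeo.summable, hgeo.tsum_eq]
  refine ENNReal.ofReal_le_ofReal ?_
  have h1 : c * Real.exp (-(n : ℝ) * s) =
      c * Real.exp (-(n : ℝ) * (s - r)) * Real.exp (-(n : ℝ) * r) := by
    have h2 : -(n : ℝ) * s = -(n : ℝ) * (s - r) + -(n : ℝ) * r := by ring
    rw [h2, Real.exp_add]
    ring
  rw [h1]
  exact mul_le_of_le_one_left (Real.exp_nonneg _) hn1.le

end Achievability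

/-- Jensen's inequality for the exponential. -/
theorem integral_le_log_of_integral_exp_le {Ω : Type*} {mΩ : MeasurableSpace Ω} {μ : Measure Ω}
    [IsProbabilityMeasure μ] {Z : Ω → ℝ} (hZ : Integrable Z μ)
    (hexp : Integrable (fun ω => Real.exp (Z ω)) μ) {J : ℝ} (hJ : ∫ ω, Real.exp (Z ω) ∂μ ≤ J) :
    ∫ ω, Z ω ∂μ ≤ Real.log J := by
  have hpos : 0 < J := (integral_exp_pos hexp).trans_le hJ
  -- The tangent line of the exponential at `log J`.
  have h1 : ∫ ω, J * (Z ω + (1 - Real.log J)) ∂μ ≤ ∫ ω, Real.exp (Z ω) ∂μ := by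
    refine integral_mono ((hZ.add (integrable_const _)).const_mul _) hexp fun ω => ?_
    have h2 := Real.add_one_le_exp (Z ω - Real.log J)
    rw [Real.exp_sub, Real.exp_log hpos, le_div_iff₀ hpos] at h2
    linarith
  rw [integral_const_mul, integral_add hZ (integrable_const _)] at h1
  simp only [integral_const, probReal_univ, smul_eq_mul, one_mul] at h1
  have h3 : J * (∫ ω, Z ω ∂μ + (1 - Real.log J)) ≤ J * 1 := by linarith
  have := le_of_mul_le_mul_left h3 hpos
  linarith

/-! ### Data processing for stopped observations. -/

section StoppedLikelihood

variable {X : Type*} {M : ℕ}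

/-- The event that a test with stopping time `τ` stops before time `m` with its stopped
observations in `D`. -/
def stopBefore (τ : Path X M → ℕ∞) (D : (k : ℕ) → Set (Fin k → Fin M → X)) (m : ℕ) :
    Set (Path X M) :=
  {ω | ∃ k < m, τ ω = (k : ℕ) ∧ pathPrefix k ω ∈ D k}

open Classical in
/-- The stopped sum, decomposed according to the value of the stopping time. -/
theorem exp_stopped_sum_eq (τ : Path X M → ℕ∞) (D : (k : ℕ) → Set (Fin k → Fin M → X)) (m : ℕ)
    (l : ℝ) (ℓ : (Fin M → X) → ℝ) (ω : Path X M) :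
    Real.exp (-(∑ i ∈ Finset.range m, if (i : ℕ∞) < τ ω then ℓ (ω i) else 0) +
        (if ω ∈ stopBefore τ D m then l else 0)) =
      ∑ k ∈ Finset.range m, (if τ ω = (k : ℕ) then
        (if pathPrefix k ω ∈ D k then Real.exp l else 1) else 0) *
          Real.exp (-∑ i ∈ Finset.range k, ℓ (ω i)) +
      (if (m : ℕ∞) ≤ τ ω then 1 else 0) * Real.exp (-∑ i ∈ Finset.range m, ℓ (ω i)) := by
  rcases le_or_gt (m : ℕ∞) (τ ω) with h | h
  · have h1 : ω ∉ stopBefore τ D m := by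
      rintro ⟨k, hk, hτ, -⟩
      rw [hτ] at h
      exact absurd (by exact_mod_cast h : m ≤ k) (not_le.2 hk)
    have h2 : ∀ k ∈ Finset.range m, (k : ℕ∞) < τ ω := fun k hk =>
      lt_of_lt_of_le (by exact_mod_cast Finset.mem_range.1 hk) h
    have h3 : ∀ k ∈ Finset.range m, (if τ ω = (k : ℕ) then
        (if pathPrefix k ω ∈ D k then Real.exp l else 1) else 0) *
          Real.exp (-∑ i ∈ Finset.range k, ℓ (ω i)) = 0 := fun k hk => by
      rw [if_neg (h2 k hk).ne', zero_mul]
    rw [if_neg h1, if_pos h, add_zero, one_mul, Finset.sum_eq_zero h3, zero_add,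
      Finset.sum_congr rfl fun i hi => if_pos (h2 i hi)]
  · obtain ⟨k, hk⟩ := ENat.ne_top_iff_exists.1 (ne_top_of_lt h)
    have hkm : k < m := by
      rw [← hk] at h
      exact_mod_cast h
    have h1 : ω ∈ stopBefore τ D m ↔ pathPrefix k ω ∈ D k := by
      constructor
      · rintro ⟨k', -, hτ, hD⟩
        rw [← hk] at hτ
        obtain rfl : k = k' := by exact_mod_cast hτ
        exact hD
      · exact fun hD => ⟨k, hkm, hk.symm, hD⟩
    have h2 : (∑ i ∈ Finset.range m, if (i : ℕ∞) < τ ω then ℓ (ω i) else 0) =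
        ∑ i ∈ Finset.range k, ℓ (ω i) := by
      rw [← Finset.sum_filter]
      refine Finset.sum_congr ?_ fun _ _ => rfl
      ext i
      rw [← hk]
      simp only [Finset.mem_filter, Finset.mem_range, Nat.cast_lt]
      omega
    rw [if_neg (not_le.2 h), zero_mul, add_zero, h2,
      Finset.sum_eq_single_of_mem k (Finset.mem_range.2 hkm), if_pos hk.symm, Real.exp_add,
      mul_comm]
    · congr 1
      by_cases hD : pathPrefix k ω ∈ D k
      · rw [if_pos hD, if_pos (h1.2 hD)]
      · rw [if_neg hD, if_neg (mt h1.1 hD), Real.exp_zero]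
    · intro k' _ hk'
      rw [if_neg, zero_mul]
      rw [← hk]
      exact_mod_cast hk'.symm

variable [MeasurableSpace X]

theorem exists_eq_preimage_pathPrefix {k : ℕ} {A : Set (Path X M)}
    (h : MeasurableSet[obsFiltration X M k] A) :
    ∃ S : Set (Fin k → Fin M → X), A = pathPrefix k ⁻¹' S := by
  obtain ⟨S, -, rfl⟩ := h
  exact ⟨S, rfl⟩

/-- The sum is the expectation of the stopping time truncated at `m`. -/
theorem sum_measureReal_lt_le {μ : Measure (Path X M)} [IsFiniteMeasure μ] {τ : Path X M → ℕ∞}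
    (hτ : IsStoppingTime (obsFiltration X M) τ) {n : ℕ} (hn : ∫⁻ ω, (τ ω : ℝ≥0∞) ∂μ ≤ n) (m : ℕ) :
    ∑ i ∈ Finset.range m, μ.real {ω | (i : ℕ∞) < τ ω} ≤ n := by
  have hmeas : ∀ i : ℕ, MeasurableSet {ω | (i : ℕ∞) < τ ω} := fun i =>
    (obsFiltration X M).le i _ (hτ.measurableSet_gt i)
  have h1 : ∑ i ∈ Finset.range m, μ {ω | (i : ℕ∞) < τ ω} ≤ n := by
    refine le_trans (le_of_eq (b := ∫⁻ ω, ∑ i ∈ Finset.range m,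
      {ω | (i : ℕ∞) < τ ω}.indicator (fun _ => 1) ω ∂μ) ?_) ((lintegral_mono fun ω => ?_).trans hn)
    · rw [lintegral_finsetSum _ fun i _ => measurable_const.indicator (hmeas i)]
      simp_rw [lintegral_indicator_const (hmeas _), one_mul]
    · simp only [Set.indicator_apply, Set.mem_ofPred_eq, Finset.sum_boole]
      have h2 : ∀ j : ℕ, ((Finset.range j).filter fun i : ℕ => (i : ℕ∞) < τ ω).card ≤ τ ω := by
        intro j
        induction j with
        | zero => simp
        | succ j ih =>
          rw [Finset.range_add_one, Finset.filter_insert]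
          split_ifs with hj
          · refine le_trans ?_ (Order.add_one_le_of_lt hj)
            refine le_trans (Nat.cast_le.2 (Finset.card_insert_le _ _)) ?_
            push_cast
            gcongr
            exact (Finset.card_filter_le _ _).trans (by simp)
          · exact ih
      have h3 := h2 m
      exact_mod_cast ENat.toENNReal_le.2 h3
  have h2 := ENNReal.toReal_mono (ENNReal.natCast_ne_top n) h1
  rw [ENNReal.toReal_sum fun i _ => measure_ne_top _ _, ENNReal.toReal_natCast] at h2
  exact h2

variable [Fintype X] [MeasurableSingletonClass X]

/-- The exponential is the likelihood ratio of `π` to `ρ`. Only an inequality holds, because `π` may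
charge symbols that `ρ` does not. -/
theorem integral_mul_exp_neg_sum_log_le {ρ π : Measure (Fin M → X)} [IsProbabilityMeasure ρ]
    [IsProbabilityMeasure π] (hρπ : ∀ z, ρ.real {z} ≠ 0 → π.real {z} ≠ 0) (k : ℕ)
    {h : (Fin k → Fin M → X) → ℝ} (hh : ∀ y, 0 ≤ h y) :
    ∫ ω, h (pathPrefix k ω) * Real.exp (-∑ i ∈ Finset.range k,
        Real.log (ρ.real {ω i} / π.real {ω i})) ∂(Measure.infinitePi fun _ : ℕ => ρ) ≤
      ∫ ω, h (pathPrefix k ω) ∂(Measure.infinitePi fun _ : ℕ => π) := by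
  have h1 := integral_pathPrefix ρ k fun y => h y * Real.exp (-∑ i : Fin k,
    Real.log (ρ.real {y i} / π.real {y i}))
  simp_rw [Finset.sum_range]
  refine (le_of_eq h1).trans ?_
  rw [integral_pathPrefix π k h]
  refine Finset.sum_le_sum fun y _ => ?_
  rw [mul_left_comm, mul_comm _ (h y)]
  refine mul_le_mul_of_nonneg_left ?_ (hh y)
  rw [← Finset.sum_neg_distrib, Real.exp_sum, ← Finset.prod_mul_distrib]
  refine Finset.prod_le_prod (fun i _ => by positivity) fun i _ => ?_
  rcases eq_or_ne (ρ.real {y i}) 0 with h0 | h0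
  · rw [h0, zero_mul]
    exact measureReal_nonneg
  · have hρ : 0 < ρ.real {y i} := lt_of_le_of_ne measureReal_nonneg h0.symm
    have hπ : 0 < π.real {y i} := lt_of_le_of_ne measureReal_nonneg (hρπ _ h0).symm
    rw [Real.exp_neg, Real.exp_log (by positivity)]
    field_simp
    exact le_rfl

theorem measurableSet_stopBefore {τ : Path X M → ℕ∞} (hτ : IsStoppingTime (obsFiltration X M) τ)
    (D : (k : ℕ) → Set (Fin k → Fin M → X)) (m : ℕ) : MeasurableSet (stopBefore τ D m) := by
  have h : stopBefore τ D m =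
      ⋃ k ∈ Finset.range m, {ω | τ ω = (k : ℕ)} ∩ pathPrefix k ⁻¹' D k := by
    ext ω
    simp only [stopBefore, Set.mem_iUnion, Finset.mem_range, Set.mem_inter_iff, Set.mem_preimage,
      Set.mem_ofPred_eq, exists_prop]
  rw [h]
  refine Finset.measurableSet_biUnion _ fun k _ => MeasurableSet.inter ?_
    (measurable_pathPrefix k (D k).toFinite.measurableSet)
  exact (obsFiltration X M).le k _ (hτ.measurableSet_eq k)

/-- Data processing up to a stopping time, with Wald's identity: the truncated form. -/
theorem mul_measureReal_stopBefore_sub_le {ρ π : Measure (Fin M → X)} [IsProbabilityMeasure ρ]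
    [IsProbabilityMeasure π] (hρπ : ∀ z, ρ.real {z} ≠ 0 → π.real {z} ≠ 0)
    {τ : Path X M → ℕ∞} (hτ : IsStoppingTime (obsFiltration X M) τ)
    (D : (k : ℕ) → Set (Fin k → Fin M → X)) (m : ℕ) (l : ℝ) :
    l * (Measure.infinitePi fun _ : ℕ => ρ).real (stopBefore τ D m) -
        (∑ i ∈ Finset.range m, (Measure.infinitePi fun _ : ℕ => ρ).real {ω | (i : ℕ∞) < τ ω}) *
          ∑ z, ρ.real {z} * Real.log (ρ.real {z} / π.real {z}) ≤
      Real.log (1 + (Measure.infinitePi fun _ : ℕ => π).real (stopBefore τ D m) *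
        (Real.exp l - 1)) := by
  classical
  set μ := Measure.infinitePi fun _ : ℕ => ρ with hμ
  set ν := Measure.infinitePi fun _ : ℕ => π with hν
  set ℓ : (Fin M → X) → ℝ := fun z => Real.log (ρ.real {z} / π.real {z}) with hℓ
  have hlt : ∀ i : ℕ, ∃ S : Set (Fin i → Fin M → X),
      {ω | (i : ℕ∞) < τ ω} = pathPrefix i ⁻¹' S := fun i => by
    obtain ⟨S, hS⟩ := exists_eq_preimage_pathPrefix (hτ i)
    refine ⟨Sᶜ, ?_⟩
    rw [Set.preimage_compl, ← hS]
    ext ω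
    exact (not_le (a := τ ω) (b := (i : ℕ∞))).symm
  have heq : ∀ i : ℕ, ∃ S : Set (Fin i → Fin M → X),
      {ω | τ ω = (i : ℕ)} = pathPrefix i ⁻¹' S := fun i =>
    exists_eq_preimage_pathPrefix (hτ.measurableSet_eq i)
  have hge : ∃ S : Set (Fin m → Fin M → X), {ω | (m : ℕ∞) ≤ τ ω} = pathPrefix m ⁻¹' S :=
    exists_eq_preimage_pathPrefix (hτ.measurableSet_ge m)
  choose S hS using hlt
  choose U hU using heq
  obtain ⟨R, hR⟩ := hge
  have hS' : ∀ (i : ℕ) ω, (i : ℕ∞) < τ ω ↔ pathPrefix i ω ∈ S i := fun i ω => Set.ext_iff.1 (hS i) ω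
  have hU' : ∀ i ω, τ ω = (i : ℕ) ↔ pathPrefix i ω ∈ U i := fun i ω => Set.ext_iff.1 (hU i) ω
  have hR' : ∀ ω, (m : ℕ∞) ≤ τ ω ↔ pathPrefix m ω ∈ R := fun ω => Set.ext_iff.1 hR ω
  have hA := measurableSet_stopBefore hτ D m
  -- Whether `i < τ` is decided by the first `i` symbols, so the `i`-th summand is a function of the
  -- first `i + 1` symbols and the symbol `ω i` is independent of the condition.
  have hL : ∀ i : ℕ, Integrable (fun ω : Path X M => if (i : ℕ∞) < τ ω then ℓ (ω i) else 0) μ :=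
    fun i => (integrable_pathPrefix μ (i + 1) fun y =>
      if (fun j : Fin i => y j.castSucc) ∈ S i then ℓ (y (Fin.last i)) else 0).congr
        (Eventually.of_forall fun ω => by simp only [hS']; rfl)
  have hLsum := integrable_finsetSum (Finset.range m) fun i _ => hL i
  have hG : ∀ μ' : Measure (Path X M), IsFiniteMeasure μ' →
      Integrable (fun ω => if ω ∈ stopBefore τ D m then l else 0) μ' := fun μ' _ =>
    (integrable_const l).indicator hA
  have hF : ∀ (μ' : Measure (Path X M)) [IsFiniteMeasure μ'] (ℓ : (Fin M → X) → ℝ) (k : ℕ),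
      Integrable (fun ω => (if τ ω = (k : ℕ) then
        (if pathPrefix k ω ∈ D k then Real.exp l else 1) else 0) *
          Real.exp (-∑ i ∈ Finset.range k, ℓ (ω i))) μ' := fun μ' _ ℓ k =>
    (integrable_pathPrefix μ' k fun y => (if y ∈ U k then
        (if y ∈ D k then Real.exp l else 1) else 0) * Real.exp (-∑ i, ℓ (y i))).congr
      (Eventually.of_forall fun ω => by simp only [hU', Finset.sum_range]; rfl)
  have hF' : ∀ (μ' : Measure (Path X M)) [IsFiniteMeasure μ'] (ℓ : (Fin M → X) → ℝ),
      Integrable (fun ω => (if (m : ℕ∞) ≤ τ ω then 1 else 0) *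
          Real.exp (-∑ i ∈ Finset.range m, ℓ (ω i))) μ' := fun μ' _ ℓ =>
    (integrable_pathPrefix μ' m fun y => (if y ∈ R then 1 else 0) *
      Real.exp (-∑ i, ℓ (y i))).congr
      (Eventually.of_forall fun ω => by simp only [hR', Finset.sum_range]; rfl)
  have hint : Integrable (fun ω => Real.exp (-(∑ i ∈ Finset.range m,
      if (i : ℕ∞) < τ ω then ℓ (ω i) else 0) + (if ω ∈ stopBefore τ D m then l else 0))) μ := by
    simp_rw [exp_stopped_sum_eq]
    exact (integrable_finsetSum _ fun k _ => hF μ ℓ k).add (hF' μ ℓ)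
  have hν1 : ∫ ω, Real.exp (if ω ∈ stopBefore τ D m then l else 0) ∂ν =
      1 + ν.real (stopBefore τ D m) * (Real.exp l - 1) := by
    have h1 : ∀ ω, Real.exp (if ω ∈ stopBefore τ D m then l else 0) =
        1 + (stopBefore τ D m).indicator (fun _ => Real.exp l - 1) ω := by
      intro ω
      by_cases hω : ω ∈ stopBefore τ D m <;> simp [hω]
    simp_rw [h1]
    rw [integral_add (integrable_const _) ((integrable_const _).indicator hA),
      integral_indicator_const _ hA]
    simp
  have hJ : ∫ ω, Real.exp (-(∑ i ∈ Finset.range m,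
      if (i : ℕ∞) < τ ω then ℓ (ω i) else 0) + (if ω ∈ stopBefore τ D m then l else 0)) ∂μ ≤
        1 + ν.real (stopBefore τ D m) * (Real.exp l - 1) := by
    -- With `ℓ = 0` the same decomposition describes the integral under `ν`; the two are then
    -- compared term by term, each at a deterministic time.
    have h0 := fun ω => exp_stopped_sum_eq τ D m l (fun _ => 0) ω
    simp only [ite_self, Finset.sum_const_zero, neg_zero, zero_add, Real.exp_zero, mul_one] at h0
    have hF0 := fun k => hF ν (fun _ => 0) k
    have hF0' := hF' ν fun _ => 0
    simp only [Finset.sum_const_zero, neg_zero, Real.exp_zero, mul_one] at hF0 hF0'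
    rw [← hν1]
    simp_rw [h0, exp_stopped_sum_eq]
    rw [integral_add (integrable_finsetSum _ fun k _ => hF μ ℓ k) (hF' μ ℓ),
      integral_add (integrable_finsetSum _ fun k _ => hF0 k) hF0',
      integral_finsetSum _ fun k _ => hF μ ℓ k, integral_finsetSum _ fun k _ => hF0 k]
    refine add_le_add (Finset.sum_le_sum fun k _ => ?_) ?_
    · simp only [hU']
      exact integral_mul_exp_neg_sum_log_le hρπ k (h := fun y => if y ∈ U k then
        (if y ∈ D k then Real.exp l else 1) else 0) fun y => by positivity
    · simp only [hR']
      exact integral_mul_exp_neg_sum_log_le hρπ m (h := fun y => if y ∈ R then 1 else 0)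
        fun y => by positivity
  have hwald : ∀ i : ℕ, ∫ ω, (if (i : ℕ∞) < τ ω then ℓ (ω i) else 0) ∂μ =
      μ.real {ω | (i : ℕ∞) < τ ω} * ∑ z, ρ.real {z} * ℓ z := by
    intro i
    have h1 := integral_pathPrefix_mul_apply ρ i ((S i).indicator fun _ => (1 : ℝ)) ℓ
    have h2 : ∫ ω, (S i).indicator (fun _ => (1 : ℝ)) (pathPrefix i ω) ∂μ =
        μ.real {ω | (i : ℕ∞) < τ ω} := by
      rw [hS, ← integral_indicator_one (measurable_pathPrefix i (S i).toFinite.measurableSet)]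
      rfl
    rw [← h2, ← h1]
    refine integral_congr_ae (Eventually.of_forall fun ω => ?_)
    by_cases hω : pathPrefix i ω ∈ S i <;> simp [hS', hω]
  have hLneg : Integrable (fun ω : Path X M => -∑ i ∈ Finset.range m,
      if (i : ℕ∞) < τ ω then ℓ (ω i) else 0) μ := hLsum.neg
  -- Jensen's inequality is applied to `l` times the indicator of the event minus the stopped
  -- log-likelihood ratio, the test function of the Donsker–Varadhan bound.
  have hmain := integral_le_log_of_integral_exp_le (hLneg.add (hG μ inferInstance)) hint hJ
  have hsum : ∫ ω, (-(∑ i ∈ Finset.range m, if (i : ℕ∞) < τ ω then ℓ (ω i) else 0) +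
      (if ω ∈ stopBefore τ D m then l else 0)) ∂μ = l * μ.real (stopBefore τ D m) -
        (∑ i ∈ Finset.range m, μ.real {ω | (i : ℕ∞) < τ ω}) * ∑ z, ρ.real {z} * ℓ z := by
    rw [integral_add hLneg (hG μ inferInstance), integral_neg,
      integral_finsetSum _ fun i _ => hL i, Finset.sum_congr rfl fun i _ => hwald i,
      ← Finset.sum_mul]
    have : ∫ ω, (if ω ∈ stopBefore τ D m then l else 0) ∂μ = l * μ.real (stopBefore τ D m) := by
      have := integral_indicator_const (μ := μ) l hA
      rw [smul_eq_mul, mul_comm] at this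
      exact this
    rw [this]
    ring
  rw [← hsum]
  exact hmain

/-- Data processing up to a stopping time of bounded expectation. -/
theorem mul_measureReal_stop_sub_le {ρ π : Measure (Fin M → X)} [IsProbabilityMeasure ρ]
    [IsProbabilityMeasure π] (hρπ : ∀ z, ρ.real {z} ≠ 0 → π.real {z} ≠ 0)
    {K : ℝ} (hK : ∑ z, ρ.real {z} * Real.log (ρ.real {z} / π.real {z}) = K) (hK0 : 0 ≤ K)
    {τ : Path X M → ℕ∞} (hτ : IsStoppingTime (obsFiltration X M) τ)
    (D : (k : ℕ) → Set (Fin k → Fin M → X)) {n : ℕ}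
    (hn : ∫⁻ ω, (τ ω : ℝ≥0∞) ∂(Measure.infinitePi fun _ : ℕ => ρ) ≤ n) {l : ℝ} (hl : 0 ≤ l) :
    l * (Measure.infinitePi fun _ : ℕ => ρ).real
        {ω | ∃ k : ℕ, τ ω = k ∧ pathPrefix k ω ∈ D k} - n * K ≤
      Real.log (1 + (Measure.infinitePi fun _ : ℕ => π).real
        {ω | ∃ k : ℕ, τ ω = k ∧ pathPrefix k ω ∈ D k} * (Real.exp l - 1)) := by
  set μ := Measure.infinitePi fun _ : ℕ => ρ with hμ
  set ν := Measure.infinitePi fun _ : ℕ => π with hν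
  set A := {ω | ∃ k : ℕ, τ ω = k ∧ pathPrefix k ω ∈ D k} with hA
  have hexp : 0 ≤ Real.exp l - 1 := by linarith [Real.add_one_le_exp l]
  have hsub : ∀ m, stopBefore τ D m ⊆ A := fun m ω ⟨k, _, hk⟩ => ⟨k, hk⟩
  have hU : A = ⋃ m, stopBefore τ D m := by
    refine Set.Subset.antisymm (fun ω ⟨k, hk⟩ => ?_) (Set.iUnion_subset hsub)
    exact Set.mem_iUnion.2 ⟨k + 1, k, Nat.lt_succ_self k, hk⟩
  have hlim : Tendsto (fun m => μ.real (stopBefore τ D m)) atTop (𝓝 (μ.real A)) := by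
    rw [hU]
    refine (ENNReal.tendsto_toReal (measure_ne_top _ _)).comp
      (tendsto_measure_iUnion_atTop fun m m' hmm' ω ⟨k, hkm, hk⟩ => ⟨k, hkm.trans_le hmm', hk⟩)
  refine le_of_tendsto ((hlim.const_mul l).sub_const (n * K)) (Eventually.of_forall fun m => ?_)
  have h1 := mul_measureReal_stopBefore_sub_le hρπ hτ D m l
  rw [hK] at h1
  have h2 := mul_le_mul_of_nonneg_right (sum_measureReal_lt_le hτ hn m) hK0
  have h3 : ν.real (stopBefore τ D m) ≤ ν.real A := measureReal_mono (hsub m)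
  have h4 : Real.log (1 + ν.real (stopBefore τ D m) * (Real.exp l - 1)) ≤
      Real.log (1 + ν.real A * (Real.exp l - 1)) := by
    refine Real.log_le_log (by positivity) ?_
    nlinarith
  linarith

end StoppedLikelihood

/-! ### Divergences of product laws. -/

section Tensorization

variable {X : Type*} {M : ℕ}

theorem exists_two_ne_zero {P : PMF X} (h : ∀ x, P x ≠ 1) :
    ∃ a b, a ≠ b ∧ P a ≠ 0 ∧ P b ≠ 0 := by
  obtain ⟨a, ha⟩ := P.support_nonempty
  have ha' : P a ≠ 0 := (P.mem_support_iff a).1 ha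
  by_contra! hcon
  refine h a ((P.apply_eq_one_iff a).2 (Set.Subset.antisymm (fun b hb => ?_) fun b hb => ?_))
  · by_contra hne
    exact (P.mem_support_iff b).1 hb (hcon a b (fun hab => hne hab.symm) ha')
  · rw [Set.mem_singleton_iff.1 hb]
    exact ha

theorem ne_zero_of_prod_ne_zero {R P : Fin M → PMF X} (hRP : ∀ j a, R j a ≠ 0 → P j a ≠ 0)
    {z : Fin M → X} (hz : ∏ j, (R j (z j)).toReal ≠ 0) (j : Fin M) :
    (R j (z j)).toReal ≠ 0 ∧ (P j (z j)).toReal ≠ 0 := by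
  have h1 := Finset.prod_ne_zero_iff.1 hz j (Finset.mem_univ j)
  have h2 : R j (z j) ≠ 0 := fun h => h1 (by rw [h, ENNReal.toReal_zero])
  exact ⟨h1, (ENNReal.toReal_pos (hRP j _ h2) ((P j).apply_ne_top _)).ne'⟩

variable [Fintype X]

/-- Marginalisation: the coordinates other than `j` sum to one. -/
theorem sum_prod_mul_apply {r : Fin M → X → ℝ} (hr : ∀ j, ∑ a, r j a = 1) (j : Fin M)
    (g : X → ℝ) : ∑ z : Fin M → X, (∏ i, r i (z i)) * g (z j) = ∑ a, r j a * g a := by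
  have h := Finset.prod_univ_sum (fun _ : Fin M => (Finset.univ : Finset X))
    fun i a => r i a * if i = j then g a else 1
  rw [Fintype.piFinset_univ, Finset.prod_eq_single j] at h
  · simp only [if_true] at h
    rw [h]
    refine Finset.sum_congr rfl fun z _ => ?_
    rw [Finset.prod_mul_distrib, Finset.prod_ite_eq' Finset.univ j fun i => g (z i),
      if_pos (Finset.mem_univ j)]
  · intro i _ hij
    simp [hij, hr]
  · exact fun hj => absurd (Finset.mem_univ j) hj

/-- Divergences of product laws add up. -/
theorem sum_symbolLaw_mul_log [MeasurableSpace X] [MeasurableSingletonClass X]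
    {R P : Fin M → PMF X} (hRP : ∀ j a, R j a ≠ 0 → P j a ≠ 0) :
    ∑ z, (symbolLaw R).real {z} * Real.log ((symbolLaw R).real {z} / (symbolLaw P).real {z}) =
      ∑ j, relEntropy (fun a => (R j a).toReal) fun a => (P j a).toReal := by
  simp_rw [symbolLaw_real_singleton]
  have h1 : ∀ z : Fin M → X, (∏ j, (R j (z j)).toReal) *
      Real.log ((∏ j, (R j (z j)).toReal) / ∏ j, (P j (z j)).toReal) =
      ∑ j, (∏ i, (R i (z i)).toReal) * Real.log ((R j (z j)).toReal / (P j (z j)).toReal) := by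
    intro z
    rcases eq_or_ne (∏ j, (R j (z j)).toReal) 0 with h | h
    · simp [h]
    · rw [← Finset.mul_sum, ← Finset.prod_div_distrib, Real.log_prod fun j _ =>
        div_ne_zero (ne_zero_of_prod_ne_zero hRP h j).1 (ne_zero_of_prod_ne_zero hRP h j).2]
  rw [Finset.sum_congr rfl fun z _ => h1 z, Finset.sum_comm]
  refine Finset.sum_congr rfl fun j _ => ?_
  exact sum_prod_mul_apply (r := fun j a => (R j a).toReal)
    (fun j => (toReal_mem_stdSimplex (R j)).2) j
    fun a => Real.log ((R j a).toReal / (P j a).toReal)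

end Tensorization

/-! ### The upper bound on the error exponent. -/

section Converse

variable {X : Type*} [Fintype X] {M T : ℕ}

theorem neg_log_div_le_coe {r : ℝ} {n : ℕ} (hn : 0 < n) {p : ℝ≥0∞}
    (hp : ENNReal.ofReal (Real.exp (-(n : ℝ) * r)) ≤ p) :
    (-ENNReal.log p) / (n : EReal) ≤ (r : EReal) := by
  rw [EReal.div_le_iff_le_mul (by exact_mod_cast hn) (EReal.natCast_ne_top n), EReal.neg_le]
  refine le_trans (le_of_eq ?_) (ENNReal.log_le_log hp)
  rw [ENNReal.log_ofReal_of_pos (Real.exp_pos _), Real.log_exp, ← EReal.coe_natCast,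
    ← EReal.coe_mul, ← EReal.coe_neg]
  congr 1
  ring

/-- A change of measure to a competing hypothesis bounds the error exponent. -/
theorem errorExponent_le_sum_relEntropy [MeasurableSpace X] [MeasurableSingletonClass X]
    {Φ : ℕ → SeqTest X M T} (hΦ : ∀ᶠ n in atTop, SatisfiesEST (Φ n) n) {PN PA W V : PMF X}
    (hWV : VanishingError Φ W V) {B C : OutlierSet M T} (hCB : C ≠ B)
    (habs : ∀ j a, hypPMF W V C j a ≠ 0 → hypPMF PN PA B j a ≠ 0) :
    errorExponent Φ PN PA B ≤ ((∑ j, relEntropy (fun a => (hypPMF W V C j a).toReal)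
      fun a => (hypPMF PN PA B j a).toReal : ℝ) : EReal) := by
  set K : ℝ := ∑ j, relEntropy (fun a => (hypPMF W V C j a).toReal)
      fun a => (hypPMF PN PA B j a).toReal with hK
  have habs' : ∀ j a, (hypPMF W V C j a).toReal ≠ 0 → (hypPMF PN PA B j a).toReal ≠ 0 := by
    intro j a h
    exact (ENNReal.toReal_pos (habs j a fun h0 => h (by rw [h0, ENNReal.toReal_zero]))
      ((hypPMF PN PA B j).apply_ne_top _)).ne'
  have hK0 : 0 ≤ K := Finset.sum_nonneg fun j _ => relEntropy_nonneg (toReal_mem_stdSimplex _)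
    (toReal_mem_stdSimplex _) (habs' j)
  have hρπ : ∀ z, (symbolLaw (hypPMF W V C)).real {z} ≠ 0 →
      (symbolLaw (hypPMF PN PA B)).real {z} ≠ 0 := by
    intro z hz
    rw [symbolLaw_real_singleton] at hz ⊢
    exact Finset.prod_ne_zero_iff.2 fun j _ => (ne_zero_of_prod_ne_zero habs hz j).2
  -- Take `r > K` and `l = n * r` in the data processing bound. If `A n` had probability below `exp
  -- (-n r)` under `B`, the right side would be at most `log 2`, while the left side `n (r p - K)`
  -- tends to infinity because `p → 1`.
  refine EReal.le_of_forall_lt_iff_le.1 fun r hr => ?_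
  have hr' : K < r := by exact_mod_cast hr
  have hr0 : 0 < r := hK0.trans_lt hr'
  let A : ℕ → Set (Path X M) := fun n =>
    {ω | ∃ k : ℕ, (Φ n).τ ω = k ∧ pathPrefix k ω ∈ {y | (Φ n).φ k y = C}}
  have hAmeas : ∀ n, MeasurableSet (A n) := by
    intro n
    have h : A n = ⋃ m, stopBefore (Φ n).τ (fun k => {y | (Φ n).φ k y = C}) m := by
      ext ω
      rw [Set.mem_iUnion]
      exact ⟨fun ⟨k, hk⟩ => ⟨k + 1, k, Nat.lt_succ_self k, hk⟩, fun ⟨m, k, _, hk⟩ => ⟨k, hk⟩⟩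
    rw [h]
    exact MeasurableSet.iUnion fun m => measurableSet_stopBefore (Φ n).isStoppingTime _ m
  have hp : Tendsto (fun n => (hypLaw W V C).real (A n)) atTop (𝓝 1) := by
    have h1 : ∀ n, (hypLaw W V C).real (A n) = 1 - (misclassProb (Φ n) W V C).toReal := by
      intro n
      have h2 := probReal_compl_eq_one_sub (μ := hypLaw W V C) (hAmeas n)
      -- The complement of `A n` contains the paths on which the test never stops, exactly as in
      -- `misclassProb`.
      have h3 : (misclassProb (Φ n) W V C).toReal = (hypLaw W V C).real (A n)ᶜ := rfl
      rw [h3, h2]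
      ring
    simp_rw [h1]
    have h4 := (ENNReal.tendsto_toReal ENNReal.zero_ne_top).comp (hWV C)
    simpa using h4.const_sub 1
  have hq : ∀ n, hypLaw PN PA B (A n) ≤ misclassProb (Φ n) PN PA B := by
    intro n
    refine measure_mono fun ω ⟨k, hk, hC⟩ ⟨k', hk', hB⟩ => hCB ?_
    rw [hk] at hk'
    obtain rfl : k = k' := by exact_mod_cast hk'
    exact (show (Φ n).φ k (pathPrefix k ω) = C from hC).symm.trans hB
  have hbig : Tendsto (fun n : ℕ => (n : ℝ) * (r * (hypLaw W V C).real (A n) - K)) atTop atTop := by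
    refine Tendsto.atTop_mul_pos (C := r * 1 - K) (by linarith) tendsto_natCast_atTop_atTop ?_
    exact (hp.const_mul r).sub_const K
  refine liminf_le_of_frequently_le' (Eventually.frequently ?_)
  filter_upwards [hΦ, eventually_gt_atTop 0, hbig.eventually_gt_atTop (Real.log 2)]
    with n hn hn0 hlarge
  refine neg_log_div_le_coe hn0 (le_trans ?_ (hq n))
  by_contra hlt
  rw [not_le, ← ofReal_measureReal, ENNReal.ofReal_lt_ofReal_iff (Real.exp_pos _)] at hlt
  have hmain := mul_measureReal_stop_sub_le hρπ (sum_symbolLaw_mul_log habs) hK0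
    (Φ n).isStoppingTime (fun k => {y | (Φ n).φ k y = C}) (hn W V C) (l := n * r) (by positivity)
  rw [← hypLaw_eq, ← hypLaw_eq] at hmain
  have h1 : Real.log (1 + (hypLaw PN PA B).real (A n) * (Real.exp (n * r) - 1)) ≤ Real.log 2 := by
    have h3 : (0 : ℝ) ≤ Real.exp (n * r) - 1 := by
      have := Real.add_one_le_exp ((n : ℝ) * r)
      have : (0 : ℝ) ≤ n * r := by positivity
      linarith
    have h4 : (0 : ℝ) ≤ (hypLaw PN PA B).real (A n) := measureReal_nonneg
    refine Real.log_le_log (by positivity) ?_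
    have h2 : Real.exp (-(n : ℝ) * r) * Real.exp (n * r) = 1 := by
      rw [← Real.exp_add, neg_mul, neg_add_cancel, Real.exp_zero]
    have h5 := mul_le_mul_of_nonneg_right hlt.le (Real.exp_nonneg (n * r))
    nlinarith
  have h2 : (n : ℝ) * r * (hypLaw W V C).real (A n) - n * K ≤ Real.log 2 := hmain.trans h1
  linarith

/-- The divergence rate between a hypothesis with outlier law `V` and nominal law `W` and one with
the laws `PA` and `PN` whose outlier sets have `t` elements in common. -/
noncomputable def overlapDivergence (PN PA : PMF X) (M T t : ℕ) (V W : X → ℝ) : ℝ :=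
  (((M : ℝ) - 2 * T + t) * relEntropy W (fun a => (PN a).toReal) +
      ((T : ℝ) - t) * relEntropy W fun a => (PA a).toReal) +
    (t * relEntropy V (fun a => (PA a).toReal) +
      ((T : ℝ) - t) * relEntropy V fun a => (PN a).toReal)

theorem sum_relEntropy_hypPMF_hypPMF (PN PA V W : PMF X) {B C : OutlierSet M T} {t : ℕ}
    (ht : (C.1 ∩ B.1).card = t) :
    ∑ j, relEntropy (fun a => (hypPMF W V C j a).toReal)
        (fun a => (hypPMF PN PA B j a).toReal) =
      overlapDivergence PN PA M T t (fun a => (V a).toReal) fun a => (W a).toReal := by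
  have hV : ∀ j ∈ C.1, hypPMF W V C j = V := fun j hj => if_pos hj
  have hW : ∀ j ∈ C.1ᶜ, hypPMF W V C j = W := fun j hj => if_neg (Finset.mem_compl.1 hj)
  rw [← Finset.sum_compl_add_sum C.1, Finset.sum_congr rfl fun j hj => by rw [hW j hj],
    Finset.sum_congr (s₁ := C.1) rfl fun j hj => by rw [hV j hj], sum_relEntropy_hypPMF,
    sum_relEntropy_hypPMF, ht, card_sdiff_cast ht, card_compl_inter_cast ht,
    card_compl_sdiff_cast ht]
  unfold overlapDivergence
  ring

/-- Join `t` elements of `B` to `T - t` elements outside; `2 * T < M` ensures that there are enough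
of the latter. -/
theorem exists_card_inter_eq (hTM : 2 * T < M) (B : OutlierSet M T) {t : ℕ} (ht : t ≤ T) :
    ∃ C : OutlierSet M T, (C.1 ∩ B.1).card = t := by
  obtain ⟨S, hSB, hS⟩ := Finset.exists_subset_card_eq (s := B.1) (n := t) (by rw [B.2]; exact ht)
  obtain ⟨R, hRB, hR⟩ := Finset.exists_subset_card_eq (s := B.1ᶜ) (n := T - t)
    (by rw [outlierSet_card_compl]; omega)
  have hdis : Disjoint R B.1 := Finset.disjoint_left.2 fun j hj => Finset.mem_compl.1 (hRB hj)
  refine ⟨⟨S ∪ R, ?_⟩, ?_⟩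
  · rw [Finset.card_union_of_disjoint ((hdis.mono_right hSB).symm), hS, hR]
    omega
  · change ((S ∪ R) ∩ B.1).card = t
    rw [Finset.union_inter_distrib_right, Finset.disjoint_iff_inter_eq_empty.1 hdis,
      Finset.union_empty, Finset.inter_eq_left.2 hSB, hS]

/-- For `t = 0` no sequence is an outlier under both hypotheses, so `V` need not be absolutely
continuous with respect to `PA`. -/
theorem errorExponent_le_overlapDivergence_of_vanishing [MeasurableSpace X]
    [MeasurableSingletonClass X] (hTM : 2 * T < M)
    {Φ : ℕ → SeqTest X M T} (hΦ : ∀ᶠ n in atTop, SatisfiesEST (Φ n) n) {PN PA V W : PMF X}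
    {t : ℕ} (ht : t < T) (hVN : ∀ a, V a ≠ 0 → PN a ≠ 0) (hVA : t ≠ 0 → ∀ a, V a ≠ 0 → PA a ≠ 0)
    (hWN : ∀ a, W a ≠ 0 → PN a ≠ 0) (hWA : ∀ a, W a ≠ 0 → PA a ≠ 0)
    (hvan : VanishingError Φ W V) (B : OutlierSet M T) :
    errorExponent Φ PN PA B ≤ (overlapDivergence PN PA M T t (fun a => (V a).toReal)
      (fun a => (W a).toReal) : ℝ) := by
  obtain ⟨C, hC⟩ := exists_card_inter_eq hTM B ht.le
  have hCB : C ≠ B := by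
    rintro rfl
    rw [Finset.inter_self, C.2] at hC
    exact ht.ne' hC
  rw [← sum_relEntropy_hypPMF_hypPMF PN PA V W hC]
  refine errorExponent_le_sum_relEntropy hΦ hvan hCB fun j a => ?_
  unfold hypPMF
  by_cases h1 : j ∈ C.1 <;> by_cases h2 : j ∈ B.1 <;> simp only [h1, h2, if_true, if_false]
  · refine hVA ?_ a
    rw [← hC]
    exact (Finset.card_pos.2 ⟨j, Finset.mem_inter.2 ⟨h1, h2⟩⟩).ne'
  · exact hVN a
  · exact hWA a
  · exact hWN a

/-- For `p = 0` division by zero makes the function identically zero, so no restriction on `p` is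
needed. -/
theorem continuous_mul_log_div (p : ℝ) : Continuous fun v : ℝ => v * Real.log (v / p) := by
  rcases eq_or_ne p 0 with rfl | hp
  · simpa using continuous_const
  · have h : (fun v : ℝ => v * Real.log (v / p)) = fun v => p * (v / p * Real.log (v / p)) := by
      funext v
      field_simp
    rw [h]
    exact continuous_const.mul (Real.continuous_mul_log.comp (continuous_id.div_const p))

theorem continuous_relEntropy_left (P : X → ℝ) : Continuous fun V : X → ℝ => relEntropy V P :=
  continuous_finsetSum _ fun a _ => (continuous_mul_log_div (P a)).comp (continuous_apply a)

/-- The probability mass function with given real values. -/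
noncomputable def pmfOfMemStdSimplex {V : X → ℝ} (hV : V ∈ stdSimplex ℝ X) : PMF X :=
  PMF.ofFintype (fun a => ENNReal.ofReal (V a)) (by
    rw [← ENNReal.ofReal_sum_of_nonneg fun a _ => hV.1 a, hV.2, ENNReal.ofReal_one])

theorem pmfOfMemStdSimplex_toReal {V : X → ℝ} (hV : V ∈ stdSimplex ℝ X) (a : X) :
    (pmfOfMemStdSimplex hV a).toReal = V a :=
  ENNReal.toReal_ofReal (hV.1 a)

theorem pmfOfMemStdSimplex_ne_zero_iff {V : X → ℝ} (hV : V ∈ stdSimplex ℝ X) (a : X) :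
    pmfOfMemStdSimplex hV a ≠ 0 ↔ V a ≠ 0 := by
  rw [← pmfOfMemStdSimplex_toReal hV a, Ne, Ne, ENNReal.toReal_eq_zero_iff, not_iff_not]
  exact ⟨Or.inl, fun h => h.resolve_right ((pmfOfMemStdSimplex hV).apply_ne_top a)⟩

/-- The case `V = W` is reached by a limit: `V` is moved slightly towards a point mass in its
support, which keeps the support and makes it differ from `W`, and the divergence is continuous in
its first argument. This needs two points in the support. -/
theorem errorExponent_le_overlapDivergence [MeasurableSpace X] [MeasurableSingletonClass X]
    (hTM : 2 * T < M) {Φ : ℕ → SeqTest X M T} (hΦ : ∀ᶠ n in atTop, SatisfiesEST (Φ n) n)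
    {PN PA V W : PMF X} {t : ℕ} (ht : t < T) (hVN : ∀ a, V a ≠ 0 → PN a ≠ 0)
    (hVA : t ≠ 0 → ∀ a, V a ≠ 0 → PA a ≠ 0) (hWN : ∀ a, W a ≠ 0 → PN a ≠ 0)
    (hWA : ∀ a, W a ≠ 0 → PA a ≠ 0)
    (hvan : ∀ V' : PMF X, (∀ a, V a ≠ 0 → V' a ≠ 0) → V' ≠ W → VanishingError Φ W V')
    (hne : V ≠ W ∨ ∃ a b, a ≠ b ∧ V a ≠ 0 ∧ V b ≠ 0) (B : OutlierSet M T) :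
    errorExponent Φ PN PA B ≤ (overlapDivergence PN PA M T t (fun a => (V a).toReal)
      (fun a => (W a).toReal) : ℝ) := by
  classical
  by_cases hVW : V = W
  swap
  · exact errorExponent_le_overlapDivergence_of_vanishing hTM hΦ ht hVN hVA hWN hWA
      (hvan V (fun _ h => h) hVW) B
  obtain ⟨a, b, hab, ha, hb⟩ := hne.resolve_left (not_not.2 hVW)
  let U : ℝ → X → ℝ := fun s x => (1 - s) * (V x).toReal + s * if x = a then 1 else 0
  have hU0 : U 0 = fun x => (V x).toReal := by
    funext x
    simp [U]
  have hcont : Continuous fun s => overlapDivergence PN PA M T t (U s) fun x => (W x).toReal := by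
    have hU : Continuous U := continuous_pi fun x => by
      simp only [U]
      fun_prop
    unfold overlapDivergence
    have h1 := (continuous_relEntropy_left fun x => (PN x).toReal).comp hU
    have h2 := (continuous_relEntropy_left fun x => (PA x).toReal).comp hU
    exact continuous_const.add ((continuous_const.mul h2).add (continuous_const.mul h1))
  have hlim : Tendsto (fun s => ((overlapDivergence PN PA M T t (U s)
      (fun x => (W x).toReal) : ℝ) : EReal)) (𝓝[>] 0) (𝓝 (overlapDivergence PN PA M T t
        (fun x => (V x).toReal) (fun x => (W x).toReal) : ℝ)) := by
    have h := (continuous_coe_real_ereal.comp hcont).tendsto 0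
    simp only [Function.comp, hU0] at h
    exact h.mono_left nhdsWithin_le_nhds
  refine ge_of_tendsto hlim ?_
  filter_upwards [Ioo_mem_nhdsGT (zero_lt_one (α := ℝ))] with s hs
  have hs0 : 0 < s := hs.1
  have hs1 : 0 < 1 - s := by linarith [hs.2]
  have hmem : U s ∈ stdSimplex ℝ X := by
    refine ⟨fun x => ?_, ?_⟩
    · have : 0 ≤ (V x).toReal := ENNReal.toReal_nonneg
      simp only [U]
      positivity
    · simp only [U]
      rw [Finset.sum_add_distrib, ← Finset.mul_sum, ← Finset.mul_sum, (toReal_mem_stdSimplex V).2]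
      simp
  have hsupp : ∀ x, U s x ≠ 0 ↔ V x ≠ 0 := by
    intro x
    constructor
    · intro h h0
      refine h ?_
      have hxa : x ≠ a := by
        rintro rfl
        exact ha h0
      simp [U, h0, hxa]
    · intro h
      have : 0 < (V x).toReal := ENNReal.toReal_pos h (V.apply_ne_top x)
      refine ne_of_gt ?_
      simp only [U]
      positivity
  have hpm : ∀ x, pmfOfMemStdSimplex hmem x ≠ 0 ↔ V x ≠ 0 := fun x =>
    (pmfOfMemStdSimplex_ne_zero_iff hmem x).trans (hsupp x)
  -- The mass at the second point `b` is multiplied by `1 - s < 1`.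
  have hneW : pmfOfMemStdSimplex hmem ≠ W := by
    intro h
    have h1 := pmfOfMemStdSimplex_toReal hmem b
    have h2 : 0 < (V b).toReal := ENNReal.toReal_pos hb (V.apply_ne_top b)
    rw [h, ← hVW] at h1
    simp only [U, if_neg hab.symm, mul_zero, add_zero] at h1
    nlinarith
  have hmain := errorExponent_le_overlapDivergence_of_vanishing hTM hΦ (PN := PN) (PA := PA)
    (V := pmfOfMemStdSimplex hmem) (W := W) ht (fun x hx => hVN x ((hpm x).1 hx))
    (fun h0 x hx => hVA h0 x ((hpm x).1 hx)) hWN hWA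
    (hvan _ (fun x hx => (hpm x).2 hx) hneW) B
  simp_rw [pmfOfMemStdSimplex_toReal] at hmain
  exact hmain

/-- The normalised geometric mean attains the bound of Gibbs' inequality. -/
theorem mul_relEntropy_add_mul_relEntropy_geomMean {P Q : X → ℝ} (hP : ∀ a, 0 ≤ P a)
    (hQ : ∀ a, 0 ≤ Q a) {u v N : ℝ} (hN : 0 < N) (hv : 0 < v) (huv : u + v = N)
    {Z : ℝ} (hZ : ∑ a, P a ^ (u / N) * Q a ^ (v / N) = Z) (hZ0 : Z ≠ 0) :
    u * relEntropy (fun a => P a ^ (u / N) * Q a ^ (v / N) / Z) P +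
      v * relEntropy (fun a => P a ^ (u / N) * Q a ^ (v / N) / Z) Q = -N * Real.log Z := by
  have key : ∀ a, u * (P a ^ (u / N) * Q a ^ (v / N) / Z *
      Real.log (P a ^ (u / N) * Q a ^ (v / N) / Z / P a)) +
      v * (P a ^ (u / N) * Q a ^ (v / N) / Z *
      Real.log (P a ^ (u / N) * Q a ^ (v / N) / Z / Q a)) =
        P a ^ (u / N) * Q a ^ (v / N) * (-N * Real.log Z / Z) := by
    intro a
    rcases eq_or_ne (P a ^ (u / N) * Q a ^ (v / N)) 0 with h | h
    · simp [h]
    have hPu := left_ne_zero_of_mul h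
    have hQv := right_ne_zero_of_mul h
    have hQ0 : Q a ≠ 0 := fun h0 => hQv (by rw [h0, Real.zero_rpow (by positivity)])
    have hlogQ : Real.log (Q a ^ (v / N)) = v / N * Real.log (Q a) :=
      Real.log_rpow (lt_of_le_of_ne (hQ a) hQ0.symm) _
    -- The weight `u` vanishes when `t = 0`; then `P a = 0` is possible, with `0 ^ 0 = 1`.
    have hcase : u = 0 ∨ P a ≠ 0 := by
      by_contra! h0
      exact hPu (by rw [h0.2, Real.zero_rpow (div_ne_zero h0.1 hN.ne')])
    have hlogP : Real.log (P a ^ (u / N)) = u / N * Real.log (P a) := by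
      rcases hcase with h0 | h0
      · simp [h0]
      · exact Real.log_rpow (lt_of_le_of_ne (hP a) h0.symm) _
    have hlog : N * Real.log (P a ^ (u / N) * Q a ^ (v / N) / Z) =
        u * Real.log (P a) + v * Real.log (Q a) - N * Real.log Z := by
      rw [Real.log_div h hZ0, Real.log_mul hPu hQv, hlogP, hlogQ]
      field_simp
    have h1 : u * Real.log (P a ^ (u / N) * Q a ^ (v / N) / Z / P a) =
        u * (Real.log (P a ^ (u / N) * Q a ^ (v / N) / Z) - Real.log (P a)) := by
      rcases hcase with h0 | h0
      · simp [h0]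
      · rw [Real.log_div (div_ne_zero h hZ0) h0]
    have h2 : Real.log (P a ^ (u / N) * Q a ^ (v / N) / Z / Q a) =
        Real.log (P a ^ (u / N) * Q a ^ (v / N) / Z) - Real.log (Q a) :=
      Real.log_div (div_ne_zero h hZ0) hQ0
    rw [mul_left_comm u, mul_left_comm v, h1, h2, ← mul_add]
    have h3 : u * (Real.log (P a ^ (u / N) * Q a ^ (v / N) / Z) - Real.log (P a)) +
        v * (Real.log (P a ^ (u / N) * Q a ^ (v / N) / Z) - Real.log (Q a)) =
        -N * Real.log Z := by
      rw [← huv] at hlog ⊢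
      linarith
    rw [h3]
    ring
  unfold relEntropy
  rw [Finset.mul_sum, Finset.mul_sum, ← Finset.sum_add_distrib,
    Finset.sum_congr rfl fun a _ => key a, ← Finset.sum_mul, hZ]
  field_simp

theorem div_mem_stdSimplex {G : X → ℝ} (hG : ∀ a, 0 ≤ G a) (h0 : ∑ a, G a ≠ 0) :
    (fun a => G a / ∑ b, G b) ∈ stdSimplex ℝ X :=
  ⟨fun a => div_nonneg (hG a) (Finset.sum_nonneg fun b _ => hG b), by
    rw [← Finset.sum_div, div_self h0]⟩

theorem rpow_mul_rpow_ne_zero_iff {p q α β : ℝ} (hp : 0 ≤ p) (hq : 0 ≤ q) (hβ : β ≠ 0) :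
    p ^ α * q ^ β ≠ 0 ↔ (α ≠ 0 → p ≠ 0) ∧ q ≠ 0 := by
  rw [Ne, mul_eq_zero, Real.rpow_eq_zero_iff_of_nonneg hp, Real.rpow_eq_zero_iff_of_nonneg hq]
  tauto

/-- The laws `V` and `W` are the normalised geometric means, which attain the bound of Gibbs'
inequality. If an affinity is zero, the term is `⊤`. The form of `hvan` serves both classes of
pairs: it asks for vanishing errors only at laws that charge the common support of `PN` and `PA`. -/
theorem errorExponent_le_overlapTerm [MeasurableSpace X] [MeasurableSingletonClass X]
    (hTM : 2 * T < M) {Φ : ℕ → SeqTest X M T} (hΦ : ∀ᶠ n in atTop, SatisfiesEST (Φ n) n)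
    {PN PA : PMF X}
    (hvan : ∀ V W : PMF X, (∀ a, PN a ≠ 0 → PA a ≠ 0 → V a ≠ 0 ∧ W a ≠ 0) → V ≠ W →
      VanishingError Φ W V)
    (hPN : ∃ a b, a ≠ b ∧ PN a ≠ 0 ∧ PN b ≠ 0) {t : ℕ} (ht : t < T) (B : OutlierSet M T) :
    errorExponent Φ PN PA B ≤ overlapTerm PN PA M T t := by
  by_cases h0 : outlierAffinity PN PA T t = 0 ∨ nominalAffinity PN PA M T t = 0
  · rw [overlapTerm_eq_top PN PA hTM ht h0]
    exact le_top
  rw [not_or] at h0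
  obtain ⟨hZV, hZW⟩ := h0
  rw [overlapTerm_eq_coe PN PA hTM ht hZV hZW]
  have ht' : (t : ℝ) < T := by exact_mod_cast ht
  have ht0 : (0 : ℝ) ≤ t := Nat.cast_nonneg t
  have hM' : 2 * (T : ℝ) < M := by exact_mod_cast hTM
  have h1 : (0 : ℝ) < T - t := by linarith
  have h2 : (0 : ℝ) < T := by linarith
  have h3 : (0 : ℝ) < M - T := by linarith
  have h4 : (0 : ℝ) < M - 2 * T + t := by linarith
  have hne : ∀ (P : PMF X) a, (P a).toReal ≠ 0 ↔ P a ≠ 0 := fun P a =>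
    ⟨fun h h0 => h (by rw [h0, ENNReal.toReal_zero]),
      fun h => (ENNReal.toReal_pos h (P.apply_ne_top a)).ne'⟩
  have hVmem := div_mem_stdSimplex (G := fun a => (PA a).toReal ^ ((t : ℝ) / T) *
    (PN a).toReal ^ (((T : ℝ) - t) / T)) (fun a => by positivity) hZV
  have hWmem := div_mem_stdSimplex (G := fun a => (PN a).toReal ^ (((M : ℝ) - 2 * T + t) /
    ((M : ℝ) - T)) * (PA a).toReal ^ (((T : ℝ) - t) / ((M : ℝ) - T)))
    (fun a => by positivity) hZW
  set V := pmfOfMemStdSimplex hVmem with hVdef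
  set W := pmfOfMemStdSimplex hWmem with hWdef
  have hZV' := hZV
  have hZW' := hZW
  unfold outlierAffinity at hZV'
  unfold nominalAffinity at hZW'
  have hV : ∀ a, V a ≠ 0 ↔ (t ≠ 0 → PA a ≠ 0) ∧ PN a ≠ 0 := by
    intro a
    rw [hVdef, pmfOfMemStdSimplex_ne_zero_iff, Ne, div_eq_zero_iff, not_or,
      and_iff_left hZV', ← Ne, rpow_mul_rpow_ne_zero_iff ENNReal.toReal_nonneg
      ENNReal.toReal_nonneg (by positivity), hne, hne, Ne, div_eq_zero_iff,
      or_iff_left h2.ne', Nat.cast_eq_zero]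
  have hW : ∀ a, W a ≠ 0 ↔ PN a ≠ 0 ∧ PA a ≠ 0 := by
    intro a
    rw [hWdef, pmfOfMemStdSimplex_ne_zero_iff, Ne, div_eq_zero_iff, not_or,
      and_iff_left hZW', ← Ne, rpow_mul_rpow_ne_zero_iff ENNReal.toReal_nonneg
      ENNReal.toReal_nonneg (by positivity), hne, hne,
      forall_prop_of_true (by positivity)]
  have hdiv : overlapDivergence PN PA M T t (fun a => (V a).toReal) (fun a => (W a).toReal) =
      overlapExponent PN PA M T t := by
    have e1 := mul_relEntropy_add_mul_relEntropy_geomMean (P := fun a => (PA a).toReal)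
      (Q := fun a => (PN a).toReal) (fun a => ENNReal.toReal_nonneg)
      (fun a => ENNReal.toReal_nonneg) (u := t) (v := (T : ℝ) - t) h2 h1 (by ring) rfl hZV
    have e2 := mul_relEntropy_add_mul_relEntropy_geomMean (P := fun a => (PN a).toReal)
      (Q := fun a => (PA a).toReal) (fun a => ENNReal.toReal_nonneg)
      (fun a => ENNReal.toReal_nonneg) (u := (M : ℝ) - 2 * T + t) (v := (T : ℝ) - t)
      (N := (M : ℝ) - T) h3 h1 (by ring) rfl hZW
    simp_rw [hVdef, hWdef, pmfOfMemStdSimplex_toReal]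
    unfold overlapDivergence overlapExponent outlierAffinity nominalAffinity
    linarith
  have hWN : ∀ a, W a ≠ 0 → PN a ≠ 0 := fun a ha => ((hW a).1 ha).1
  have hWA : ∀ a, W a ≠ 0 → PA a ≠ 0 := fun a ha => ((hW a).1 ha).2
  rw [← hdiv]
  -- If the optimal laws coincide, the competitor with no overlap and outlier law `PN` is at least
  -- as good: its rate is smaller by `T D(W‖PN)`. Should `PN = W` hold too, the perturbation applies
  -- because `PN` is not a point mass.
  by_cases hVW : V = W
  · have hmain := errorExponent_le_overlapDivergence hTM hΦ (PN := PN) (PA := PA) (V := PN)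
      (W := W) (t := 0) (by omega) (fun a h => h) (fun h => absurd rfl h) hWN hWA
      (fun V' hV' hne => hvan V' W (fun a ha ha' => ⟨hV' a ha, (hW a).2 ⟨ha, ha'⟩⟩) hne)
      (Or.inr hPN) B
    refine hmain.trans (EReal.coe_le_coe_iff.2 ?_)
    have hself : relEntropy (fun a => (PN a).toReal) (fun a => (PN a).toReal) = 0 := by
      refine Finset.sum_eq_zero fun a _ => ?_
      rcases eq_or_ne (PN a).toReal 0 with h | h
      · simp [h]
      · simp [div_self h]
    have hD := relEntropy_nonneg (toReal_mem_stdSimplex W) (toReal_mem_stdSimplex PN)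
      fun a ha => (hne PN a).2 (hWN a ((hne W a).1 ha))
    rw [hVW]
    unfold overlapDivergence
    rw [hself]
    push_cast
    nlinarith [mul_nonneg h2.le hD]
  · exact errorExponent_le_overlapDivergence hTM hΦ ht (fun a ha => ((hV a).1 ha).2)
      (fun h a ha => ((hV a).1 ha).1 h) hWN hWA
      (fun V' hV' hne => hvan V' W (fun a ha ha' =>
        ⟨hV' a ((hV a).2 ⟨fun _ => ha', ha⟩), (hW a).2 ⟨ha, ha'⟩⟩) hne) (Or.inl hVW) B

end Converse

end OutlierTest

open OutlierTest in
theorem theorem5 {X : Type*} [Fintype X] [DecidableEq X] [Nontrivial X] [MeasurableSpace X]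
    [MeasurableSingletonClass X] (M T : ℕ) (hT : 0 < T) (hTM : 2 * T < M) :
    -- the sequential test, with any choice of minimal score decision rules
    (∀ φ : ℕ → (k : ℕ) → (Fin k → Fin M → X) → OutlierSet M T,
      (∀ n, IsMinScoreRule (φ n)) →
        (∀ n : ℕ, 2 ≤ n → SatisfiesEST (seqTest n (φ n)) n) ∧
        (∀ PN PA : PMF X, (∀ x, PN x ≠ 0) → (∀ x, PA x ≠ 0) → ∀ B : OutlierSet M T,
          LD PN PA M T ≤ errorExponent (fun n => seqTest n (φ n)) PN PA B)) ∧
    -- the converse, for families of tests that meet the constraint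
    (∀ Φ : ℕ → SeqTest X M T, (∀ᶠ n in atTop, SatisfiesEST (Φ n) n) →
      -- on the class of fully supported pairs
      ((∀ PN PA : PMF X, (∀ x, PN x ≠ 0) → (∀ x, PA x ≠ 0) → PN ≠ PA → VanishingError Φ PN PA) →
        ∀ PN PA : PMF X, (∀ x, PN x ≠ 0) → (∀ x, PA x ≠ 0) → ∀ B : OutlierSet M T,
          errorExponent Φ PN PA B ≤ LD PN PA M T) ∧
      -- on the class of all pairs
      ((∀ PN PA : PMF X, PN ≠ PA → VanishingError Φ PN PA) →
        ∀ PN PA : PMF X, (∀ x, PN x ≠ 1) → ∀ B : OutlierSet M T,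
          errorExponent Φ PN PA B ≤ LD PN PA M T)) := by
  refine ⟨fun φ hφ => ⟨fun n hn => satisfiesEST_seqTest hT hTM hn (φ n),
    fun PN PA hN hA B => LD_le_errorExponent_seqTest hT hTM hN hA B hφ⟩, fun Φ hΦ => ⟨?_, ?_⟩⟩
  · intro hvan PN PA hN hA B
    refine le_LD_of_forall_le_overlapTerm PN PA fun t ht =>
      errorExponent_le_overlapTerm hTM hΦ (fun V W hVW hne => ?_) ?_ ht B
    · exact hvan W V (fun x => (hVW x (hN x) (hA x)).2) (fun x => (hVW x (hN x) (hA x)).1) hne.symm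
    · obtain ⟨a, b, hab⟩ := exists_pair_ne X
      exact ⟨a, b, hab, hN a, hN b⟩
  · intro hvan PN PA hN B
    exact le_LD_of_forall_le_overlapTerm PN PA fun t ht =>
      errorExponent_le_overlapTerm hTM hΦ (fun V W _ hne => hvan W V hne.symm)
        (exists_two_ne_zero hN) ht B
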